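/- Let $n\ge 1$ and let $\mathfrak g_n$ be either $\mathfrak{gl}(n,\mathbb C)$ or $\mathfrak{so}(n,\mathbb C)$, the latter realized as the Lie algebra of complex skew-symmetric $n\times n$ matrices, and for $1\le i\le n$ let $\mathfrak g_i$ be the corresponding Lie algebra of $i\times i$ matrices. Let $r_i$ be the rank of $\mathfrak g_i$, so $r_i=i$ for $\mathfrak{gl}(i)$ and $r_i=\lfloor i/2\rfloor$ for $\mathfrak{so}(i)$. For $x\in\mathfrak g_n$ let $x_i\in\mathfrak g_i$ be the top left $i\times i$ corner of $x$, and let $\sigma(x_i)$ be the set of eigenvalues of the $i\times i$ matrix $x_i$. Put $$(\mathfrak g_n)_\Omega=\{x\in\mathfrak g_n : x_i \text{ is regular semisimple in } \mathfrak g_i \text{ and } \sigma(x_{i-1})\cap\sigma(x_i)=\emptyset \text{ for } 2\le i\le n\},$$ where $y\in\mathfrak g_i$ is called regular if its centralizer in $\mathfrak g_i$ has dimension $r_i$. Define polynomial functions $f_{i,j}$, $1\le j\le r_i$, on $\mathfrak g_n$ by $f_{i,j}(x)=\operatorname{tr}(x_i^{\,j})$ if $\mathfrak g_n=\mathfrak{gl}(n)$.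 If $\mathfrak g_n=\mathfrak{so}(n)$, let $f_{i,j}(x)=\operatorname{tr}(x_i^{\,2j})$, except that $f_{i,l}(x)=\operatorname{Pfaff}(x_i)$ when $i=2l$ is even and $j=l$. Let $x\in(\mathfrak g_n)_\Omega$, and let $\mathcal O_x$ be its orbit under the adjoint group of $\mathfrak g_n$, with the Kostant-Kirillov-Souriau symplectic form $\omega_y([a,y],[b,y])=\operatorname{tr}(y[a,b])$ for $y\in\mathcal O_x$ and $a,b\in\mathfrak g_n$. Then the functions $q_{i,j}=f_{i,j}|_{\mathcal O_x}$, $1\le i\le n-1$, $1\le j\le r_i$, form a completely integrable system on $(\mathcal O_x,\omega)$. That is, their number $\sum_{i=1}^{n-1}r_i$ equals $\tfrac12\dim_{\mathbb C}\mathcal O_x$, they pairwise Poisson commute on $\mathcal O_x$, and their differentials are linearly independent at every point of some open dense subset of $\mathcal O_x$. -/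

import Mathlib

open scoped Topology

namespace GelfandZeitlin

attribute [local instance] LieRing.ofAssociativeRing

/-- Square complex matrices of size `n`. -/
abbrev Mat (n : ℕ) : Type := Matrix (Fin n) (Fin n) ℂ

/-- The two families of Lie algebras under consideration. -/
inductive Family : Type
  | gl
  | so

/-- The Lie algebra `𝔤ₙ`: all `n × n` complex matrices for the family `gl`, the skew-symmetric ones
(`Aᵀ = -A`) for the family `so`. -/
noncomputable def lieAlg (t : Family) (n : ℕ) : LieSubalgebra ℂ (Mat n) :=
  match t with
  | .gl => ⊤
  | .so => LieAlgebra.Orthogonal.so (Fin n) ℂ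

/-- The rank `rₙ` of `𝔤ₙ`: `n` for `gl(n)`, and `l` for `so(2l)` and `so(2l+1)`. -/
def rank (t : Family) (n : ℕ) : ℕ :=
  match t with
  | .gl => n
  | .so => n / 2

/-- The `i × i` cutoff of `x`, its top left hand corner. -/
def cutoff {n i : ℕ} (h : i ≤ n) (x : Mat n) : Mat i :=
  x.submatrix (Fin.castLE h) (Fin.castLE h)

/-- The Pfaffian of a skew-symmetric matrix of even size `m = 2l`,
`(2ˡ l!)⁻¹ ∑_{σ ∈ S_{2l}} sgn(σ) ∏_{k < l} a_{σ(2k), σ(2k+1)}`. (Only used for even `m`.) -/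
noncomputable def pfaffian {m : ℕ} (a : Mat m) : ℂ :=
  ((2 : ℂ) ^ (m / 2) * ((m / 2).factorial : ℂ))⁻¹ *
    ∑ σ : Equiv.Perm (Fin m), ((Equiv.Perm.sign σ : ℤ) : ℂ) *
      ∏ k : Fin (m / 2), a (σ ⟨2 * k.1, by omega⟩) (σ ⟨2 * k.1 + 1, by omega⟩)

/-- The chosen generators of the invariant polynomials on `𝔤ᵢ`. The index `j : Fin rᵢ` counts from
`0`, so that `invariant t i j` is the `(j+1)`-st generator:
* `gl(i)`: `tr(y^(j+1))`, for `j + 1 = 1, …, i`;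
* `so(2l)`: `tr(y^(2(j+1)))` for `j + 1 = 1, …, l - 1`, and the Pfaffian for `j + 1 = l`;
* `so(2l+1)`: `tr(y^(2(j+1)))` for `j + 1 = 1, …, l`. -/
noncomputable def invariant (t : Family) (i : ℕ) (j : Fin (rank t i)) (y : Mat i) : ℂ :=
  match t with
  | .gl => (y ^ (j.1 + 1)).trace
  | .so => if Even i ∧ j.1 + 1 = rank .so i then pfaffian y else (y ^ (2 * (j.1 + 1))).trace

/-- The pairs `(i, j)` with `1 ≤ i ≤ n - 1` and `1 ≤ j ≤ rᵢ` (with `j` shifted to start at `0`). -/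
abbrev Index (t : Family) (n : ℕ) : Type :=
  Σ i : Finset.Icc 1 (n - 1), Fin (rank t i.1)

theorem Index.le {t : Family} {n : ℕ} (p : Index t n) : p.1.1 ≤ n :=
  (Finset.mem_Icc.mp p.1.2).2.trans (Nat.sub_le n 1)

/-- The Gelfand-Zeitlin function `f_{i,j}(x) = f_{i,j}(xᵢ)`. It is given by the same polynomial
formula on all matrices; only its restriction to an adjoint orbit in `𝔤ₙ` matters. -/
noncomputable def gzFunction (t : Family) (n : ℕ) (p : Index t n) (x : Mat n) : ℂ :=
  invariant t p.1.1 p.2 (cutoff p.le x)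

/-- The centralizer of `y` in `𝔤ᵢ`. -/
noncomputable def centralizer (t : Family) (i : ℕ) (y : Mat i) : Submodule ℂ (Mat i) :=
  (lieAlg t i).toSubmodule ⊓ LinearMap.ker (LieAlgebra.ad ℂ (Mat i) y)

/-- `y` is regular semisimple in `𝔤ᵢ`: its centralizer has dimension `rᵢ` and `y` acts
semisimply, i.e. is a diagonalizable matrix. -/
def IsRegularSemisimple (t : Family) (i : ℕ) (y : Mat i) : Prop :=
  Module.finrank ℂ (centralizer t i y) = rank t i ∧ Module.End.IsSemisimple (Matrix.toLin' y)

/-- The set `(𝔤ₙ)_Ω`: for `2 ≤ i ≤ n` the cutoff `xᵢ` is regular semisimple in `𝔤ᵢ`, and `xᵢ₋₁` and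
`xᵢ` have no common eigenvalue. -/
def omegaSet (t : Family) (n : ℕ) : Set (Mat n) :=
  {x | x ∈ lieAlg t n ∧ ∀ (i : ℕ) (_ : 2 ≤ i) (hi : i ≤ n),
    IsRegularSemisimple t i (cutoff hi x) ∧
    Disjoint (spectrum ℂ (cutoff ((Nat.sub_le i 1).trans hi) x)) (spectrum ℂ (cutoff hi x))}

/-- The connected Lie group `Gₙ` of invertible matrices with Lie algebra `𝔤ₙ`, i.e. the group
generated by the matrix exponentials of the elements of `𝔤ₙ`. (It is `GLₙ(ℂ)`, resp. `SOₙ(ℂ)`.)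
Since `Ad(exp z) = exp(ad z)`, its image under `Ad` is the adjoint group of `𝔤ₙ`, the group
generated by the `exp(ad z)`, `z ∈ 𝔤ₙ`. -/
noncomputable def group (t : Family) (n : ℕ) : Subgroup (Mat n)ˣ :=
  Subgroup.closure {g | ∃ z ∈ lieAlg t n, (g : Mat n) = NormedSpace.exp z}

/-- The adjoint orbit `𝒪ₓ = {g x g⁻¹ : g ∈ Gₙ}`. -/
def adjointOrbit (t : Family) (n : ℕ) (x : Mat n) : Set (Mat n) :=
  {y | ∃ g ∈ group t n, y = (g : Mat n) * x * ((g⁻¹ : (Mat n)ˣ) : Mat n)}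

/-- The (holomorphic) tangent space at `y` of a complex submanifold `M` of the space of matrices,
spanned by the velocities at `y` of holomorphic curves in `M` through `y`. -/
def tangentSpace {n : ℕ} (M : Set (Mat n)) (y : Mat n) : Submodule ℂ (Mat n) :=
  Submodule.span ℂ {v | ∃ γ : ℂ → Mat n, γ 0 = y ∧ (∀ᶠ s in 𝓝 (0 : ℂ), γ s ∈ M) ∧
    ∀ a b, AnalyticAt ℂ (fun s => γ s a b) 0 ∧ HasDerivAt (fun s => γ s a b) (v a b) 0}

/-- The differential at `y` of the restriction of a function `f` to `M`: the derivatives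
`∂_y^v f = d/ds|_{s=0} f(y + s v)` in the directions `v` tangent to `M`. -/
noncomputable def differential {n : ℕ} (M : Set (Mat n)) (f : Mat n → ℂ) (y : Mat n) :
    tangentSpace M y → ℂ :=
  fun v => lineDeriv ℂ f y (v : Mat n)

open Classical in
/-- The Kostant-Kirillov-Souriau form on the adjoint orbits of `𝔤ₙ`, with respect to the trace form
`β(a, b) = tr(ab)`. At `y` it is given on tangent vectors `[a, y]`, `[b, y]` (`a, b ∈ 𝔤ₙ`) by
`ω_y([a, y], [b, y]) = β(y, [a, b])`; see `kks_apply` for the independence of `a` and `b`.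
(Every tangent vector of the orbit at `y` is of the form `[a, y]`; elsewhere the value is `0`.) -/
noncomputable def kks (t : Family) (n : ℕ) (y u v : Mat n) : ℂ :=
  if h : ∃ c : Mat n × Mat n,
      c.1 ∈ lieAlg t n ∧ c.2 ∈ lieAlg t n ∧ ⁅c.1, y⁆ = u ∧ ⁅c.2, y⁆ = v then
    (y * ⁅h.choose.1, h.choose.2⁆).trace
  else 0

theorem trace_mul_lie {n : ℕ} (y a b : Mat n) : (y * ⁅a, b⁆).trace = -(⁅a, y⁆ * b).trace := by
  simp only [Ring.lie_def, mul_sub, sub_mul, Matrix.trace_sub]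
  rw [← mul_assoc, Matrix.trace_mul_comm y (b * a), mul_assoc b a y,
    Matrix.trace_mul_comm b (a * y)]
  ring

theorem kks_apply (t : Family) (n : ℕ) (y a b : Mat n) (ha : a ∈ lieAlg t n)
    (hb : b ∈ lieAlg t n) : kks t n y ⁅a, y⁆ ⁅b, y⁆ = (y * ⁅a, b⁆).trace := by
  have h : ∃ c : Mat n × Mat n,
      c.1 ∈ lieAlg t n ∧ c.2 ∈ lieAlg t n ∧ ⁅c.1, y⁆ = ⁅a, y⁆ ∧ ⁅c.2, y⁆ = ⁅b, y⁆ :=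
    ⟨(a, b), ha, hb, rfl, rfl⟩
  obtain ⟨-, -, h1, h2⟩ := h.choose_spec
  have e1 : ∀ a' b' : Mat n, (y * ⁅a', b'⁆).trace = -(y * ⁅b', a'⁆).trace := by
    intro a' b'
    rw [← lie_skew, mul_neg, Matrix.trace_neg]
  rw [kks, dif_pos h, trace_mul_lie, h1, ← trace_mul_lie, e1, trace_mul_lie, h2, ← trace_mul_lie,
    ← e1]

/-- `ξ` is the value at `y` of the Hamiltonian vector field of `f|_M` for the 2-form `ω` on `M`: it is
tangent to `M` and `d(f|_M)_y(v) = ω_y(v, ξ)` for all tangent vectors `v`. -/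
def IsHamiltonianVector {n : ℕ} (M : Set (Mat n)) (ω : Mat n → Mat n → Mat n → ℂ)
    (f : Mat n → ℂ) (y ξ : Mat n) : Prop :=
  ξ ∈ tangentSpace M y ∧ ∀ v : tangentSpace M y, differential M f y v = ω y v ξ

/-- The restrictions to the symplectic manifold `(M, ω)` of the functions `fₖ`, `k ∈ ι`, form a
completely integrable system: they are `d = dim M / 2` functions that Poisson commute and are
independent, i.e. have linearly independent differentials on an open dense subset of `M`. -/
structure IsCompletelyIntegrableSystem {n : ℕ} (M : Set (Mat n))
    (ω : Mat n → Mat n → Mat n → ℂ) {ι : Type} [Fintype ι] (f : ι → Mat n → ℂ) : Prop where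
  /-- The number of functions is half the dimension of `M`. -/
  dim_eq : ∀ y ∈ M, Module.finrank ℂ (tangentSpace M y) = 2 * Fintype.card ι
  /-- The Hamiltonian vector fields exist and are unique. -/
  hamiltonian : ∀ y ∈ M, ∀ k, ∃! ξ, IsHamiltonianVector M ω (f k) y ξ
  /-- The Poisson brackets `{f_k, f_l} = ω(ξ_{f_k}, ξ_{f_l})` vanish on `M`. -/
  poisson_commute : ∀ y ∈ M, ∀ k l ξ η, IsHamiltonianVector M ω (f k) y ξ →
    IsHamiltonianVector M ω (f l) y η → ω y ξ η = 0
  /-- The differentials are linearly independent on `M ∩ U`, which is open and dense in `M`. -/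
  independent : ∃ U : Set (Mat n), IsOpen U ∧ M ⊆ closure (M ∩ U) ∧
    ∀ y ∈ M ∩ U, LinearIndependent ℂ (fun k => differential M (f k) y)

end GelfandZeitlin

/-! The trace form is nondegenerate on `𝔤ₙ`, so on `𝔤ₙ` the differential of `f_{i,j}` at `y` is
`tr(G ·)`, with `G` the gradient of the invariant at `yᵢ` extended by zeros. The tangent vectors of
the orbit are the `[a, y]` (`mem_tangentSpace_iff`), the Hamiltonian vector is `[y, G]`
(`isHamiltonianVector_iff`), and Poisson brackets become `tr(y [G, G'])`. These vanish because the
gradient on the larger of two nested corners commutes with that corner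
(`trace_mul_lie_resize_eq_zero`). The dimension follows from regularity and `dim 𝔤ₙ = rₙ + 2 ∑_{i<n}
rᵢ`.

Independence at `x` (`eq_zero_of_commute_gradient`): if a combination of the differentials kills all
`[a, x]`, its gradient commutes with `x`. This produces `Zᵢ` centralizing `xᵢ`, `1 ≤ i ≤ n`, whose
extensions by zero sum to `0`. The top one has zero last column, hence intertwines `xₙ` with `xₙ₋₁`;
disjointness of spectra kills it, and one descends. Within one level the gradients are independent:
up to nonzero scalars, and after multiplication by `xᵢ` in the `so` case, they are distinct powers
of `xᵢ` with exponent below `i`. The Pfaffian gives exponent `0`, provided `Pf(xᵢ) ≠ 0`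
(`pfaffian_ne_zero`). That `xᵢ` is regular enough for this is `isStronglyRegularCutoff_of_omega`.

Density: independence is implied by the nonvanishing of a holomorphic function that is nonzero at
`x`. Every point of the orbit is joined to `x` by an entire curve in the orbit, so the identity
theorem applies (`subset_closure_ne_zero`). -/

open scoped Topology

namespace GelfandZeitlin

attribute [local instance] LieRing.ofAssociativeRing

/-! ### The Pfaffian under congruence, and its value on the standard form -/

section Pfaffian

/-- The bijection `(k, c) ↦ 2k + c` for even `m`. -/
def pairEquiv {m : ℕ} (hm : Even m) : Fin (m / 2) × Fin 2 ≃ Fin m :=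
  finProdFinEquiv.trans (finCongr (Nat.div_mul_cancel hm.two_dvd))

theorem pairEquiv_zero {m : ℕ} (hm : Even m) (k : Fin (m / 2)) :
    pairEquiv hm (k, 0) = ⟨2 * k.1, by omega⟩ := by
  ext; simp [pairEquiv]

theorem pairEquiv_one {m : ℕ} (hm : Even m) (k : Fin (m / 2)) :
    pairEquiv hm (k, 1) = ⟨2 * k.1 + 1, by omega⟩ := by
  ext; simp [pairEquiv]; omega

theorem prod_pairs {m : ℕ} (hm : Even m) (f : Fin m → ℂ) :
    ∏ i, f i = ∏ k : Fin (m / 2), f ⟨2 * k.1, by omega⟩ * f ⟨2 * k.1 + 1, by omega⟩ := by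
  rw [← (pairEquiv hm).prod_comp, Fintype.prod_prod_type]
  refine Finset.prod_congr rfl fun k _ => ?_
  rw [Fin.prod_univ_two, pairEquiv_zero, pairEquiv_one]

theorem sum_maps_pairs {m : ℕ} (hm : Even m) (F : (Fin (m / 2) → Fin m × Fin m) → ℂ) :
    ∑ q, F q =
      ∑ τ : Fin m → Fin m, F fun k => (τ ⟨2 * k.1, by omega⟩, τ ⟨2 * k.1 + 1, by omega⟩) := by
  symm
  refine Fintype.sum_bijective
    (fun (τ : Fin m → Fin m) (k : Fin (m / 2)) =>
      (τ ⟨2 * k.1, by omega⟩, τ ⟨2 * k.1 + 1, by omega⟩)) ⟨?_, ?_⟩ _ _ fun _ => rfl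
  · intro τ τ' h
    funext i
    obtain ⟨⟨k, c⟩, rfl⟩ := (pairEquiv hm).surjective i
    have hk := congrFun h k
    simp only [Prod.mk.injEq, ← pairEquiv_zero hm, ← pairEquiv_one hm] at hk
    fin_cases c
    · exact hk.1
    · exact hk.2
  · intro q
    refine ⟨fun i => if ((pairEquiv hm).symm i).2 = 0 then (q ((pairEquiv hm).symm i).1).1
      else (q ((pairEquiv hm).symm i).1).2, ?_⟩
    funext k
    simp only [← pairEquiv_zero hm, ← pairEquiv_one hm]
    simp

/-- Expanding each entry turns the product into a sum over all maps `τ`. Summing over `σ` first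
leaves the determinant of `g` with columns selected by `τ`, which vanishes for a repeated column and
is `sign τ * det g` for a permutation. -/
theorem pfaffian_conj {m : ℕ} (hm : Even m) (g A : Mat m) :
    pfaffian (g * A * g.transpose) = g.det * pfaffian A := by
  have key : ∀ σ : Equiv.Perm (Fin m),
      (∏ k : Fin (m / 2), (g * A * g.transpose) (σ ⟨2 * k.1, by omega⟩) (σ ⟨2 * k.1 + 1, by omega⟩))
      = ∑ τ : Fin m → Fin m,
        (∏ k : Fin (m / 2), A (τ ⟨2 * k.1, by omega⟩) (τ ⟨2 * k.1 + 1, by omega⟩)) *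
          ∏ i, g (σ i) (τ i) := by
    intro σ
    have h1 : ∀ a b, (g * A * g.transpose) a b
        = ∑ p : Fin m × Fin m, A p.1 p.2 * (g a p.1 * g b p.2) := by
      intro a b
      rw [Fintype.sum_prod_type, Finset.sum_comm]
      simp only [Matrix.mul_apply, Matrix.transpose_apply, Finset.sum_mul]
      exact Finset.sum_congr rfl fun p _ => Finset.sum_congr rfl fun q _ => by ring
    simp only [h1]
    rw [Finset.prod_univ_sum, Fintype.piFinset_univ, sum_maps_pairs hm]
    refine Finset.sum_congr rfl fun τ _ => ?_
    rw [Finset.prod_mul_distrib, prod_pairs hm]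
  unfold pfaffian
  rw [mul_left_comm]
  congr 1
  simp only [key, Finset.mul_sum]
  rw [Finset.sum_comm]
  have h2 : ∀ τ : Fin m → Fin m, (∑ σ : Equiv.Perm (Fin m), ((Equiv.Perm.sign σ : ℤ) : ℂ) *
      ((∏ k : Fin (m / 2), A (τ ⟨2 * k.1, by omega⟩) (τ ⟨2 * k.1 + 1, by omega⟩)) *
          ∏ i, g (σ i) (τ i))) =
      (∏ k : Fin (m / 2), A (τ ⟨2 * k.1, by omega⟩) (τ ⟨2 * k.1 + 1, by omega⟩)) *
        (g.submatrix id τ).det := by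
    intro τ
    rw [Matrix.det_apply', Finset.mul_sum]
    exact Finset.sum_congr rfl fun σ _ => by simp only [Matrix.submatrix_apply, id]; ring
  simp only [h2]
  symm
  refine Fintype.sum_of_injective (fun σ : Equiv.Perm (Fin m) => (σ : Fin m → Fin m))
    DFunLike.coe_injective _ _ ?_ ?_
  · intro τ hτ
    have hni : ¬ Function.Injective τ := fun hi =>
      hτ ⟨Equiv.ofBijective τ (Finite.injective_iff_bijective.mp hi), rfl⟩
    obtain ⟨a, b, hab, hne⟩ : ∃ a b, τ a = τ b ∧ a ≠ b := by
      simpa [Function.Injective] using hni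
    rw [Matrix.det_zero_of_column_eq hne (fun i => by simp [hab]), mul_zero]
  · intro σ
    rw [Matrix.det_permute']
    ring

/-- The standard skew-symmetric matrix with blocks `(0, 1; -1, 0)` on the diagonal. -/
noncomputable def stdSkew {m : ℕ} (hm : Even m) : Mat m :=
  Matrix.of fun i j => if ((pairEquiv hm).symm i).1 = ((pairEquiv hm).symm j).1 then
    ((((pairEquiv hm).symm j).2 : ℕ) : ℂ) - ((((pairEquiv hm).symm i).2 : ℕ) : ℂ) else 0

theorem stdSkew_apply {m : ℕ} (hm : Even m) (p q : Fin (m / 2) × Fin 2) :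
    stdSkew hm (pairEquiv hm p) (pairEquiv hm q) =
      if p.1 = q.1 then ((q.2 : ℕ) : ℂ) - ((p.2 : ℕ) : ℂ) else 0 := by
  simp [stdSkew]

theorem stdSkew_transpose {m : ℕ} (hm : Even m) : (stdSkew hm).transpose = -stdSkew hm := by
  ext i j
  simp only [stdSkew, Matrix.transpose_apply, Matrix.neg_apply, Matrix.of_apply]
  split_ifs with h1 h2 h2
  · ring
  · exact absurd h1.symm h2
  · exact absurd h2.symm h1
  · simp

/-- No cancellation occurs: each term is `1` if `σ` maps pairs to pairs and `0` otherwise, and the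
identity contributes a `1`. -/
theorem pfaffian_stdSkew_ne_zero {m : ℕ} (hm : Even m) : pfaffian (stdSkew hm) ≠ 0 := by
  set e := pairEquiv hm with he
  have hJ : ∀ p q, stdSkew hm (e p) (e q) =
      if p.1 = q.1 then ((q.2 : ℕ) : ℂ) - ((p.2 : ℕ) : ℂ) else 0 := stdSkew_apply hm
  have hterm : ∀ σ : Equiv.Perm (Fin m), ((Equiv.Perm.sign σ : ℤ) : ℂ) *
      ∏ k : Fin (m / 2), stdSkew hm (σ ⟨2 * k.1, by omega⟩) (σ ⟨2 * k.1 + 1, by omega⟩) =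
      if ∀ k, ∃ (k' : Fin (m / 2)) (ε : Equiv.Perm (Fin 2)), ∀ c, σ (e (k, c)) = e (k', ε c)
        then 1 else 0 := by
    intro σ
    simp only [← pairEquiv_zero hm, ← pairEquiv_one hm, ← he]
    split_ifs with h
    · choose τ ε hτ using h
      have hτi : Function.Injective τ := by
        intro a b hab
        have h1 := hτ a ((ε a).symm 0)
        have h2 := hτ b ((ε b).symm 0)
        rw [Equiv.apply_symm_apply] at h1 h2
        have h3 := h1.trans ((congrArg (fun z => e (z, 0)) hab).trans h2.symm)
        exact congrArg Prod.fst (e.injective (σ.injective h3))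
      let τ' : Equiv.Perm (Fin (m / 2)) :=
        Equiv.ofBijective τ (Finite.injective_iff_bijective.mp hτi)
      have hσ : σ = (e.symm.trans ((Equiv.prodCongrRight ε).trans
          (Equiv.prodCongrLeft fun _ : Fin 2 => τ'))).trans e := by
        ext1 i
        obtain ⟨⟨k, c⟩, rfl⟩ := e.surjective i
        simpa [τ', Equiv.prodCongrLeft, Equiv.prodCongrRight] using hτ k c
      -- The permutation `τ'` of the pairs acts on both members of each pair, so its sign enters
      -- squared.
      have hs : Equiv.Perm.sign σ = ∏ k, Equiv.Perm.sign (ε k) := by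
        rw [hσ, Equiv.Perm.sign_symm_trans_trans, Equiv.Perm.sign_trans,
          Equiv.Perm.sign_prodCongrLeft, Equiv.Perm.sign_prodCongrRight]
        simp
      have hε : ∀ π : Equiv.Perm (Fin 2), ((π 1 : ℕ) : ℂ) - ((π 0 : ℕ) : ℂ)
          = ((Equiv.Perm.sign π : ℤ) : ℂ) := by
        intro π
        have : ((π 1 : ℕ) : ℤ) - ((π 0 : ℕ) : ℤ) = (Equiv.Perm.sign π : ℤ) := by
          revert π; decide
        exact_mod_cast this
      simp only [hτ, hJ, if_true, hε, hs]
      push_cast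
      rw [← Finset.prod_mul_distrib]
      refine Finset.prod_eq_one fun k _ => ?_
      rcases Int.units_eq_one_or (Equiv.Perm.sign (ε k)) with h | h <;> simp [h]
    · obtain ⟨k, hk⟩ := not_forall.mp h
      rw [Finset.prod_eq_zero (Finset.mem_univ k), mul_zero]
      obtain ⟨⟨a, c⟩, ha⟩ := e.surjective (σ (e (k, 0)))
      obtain ⟨⟨b, d⟩, hb⟩ := e.surjective (σ (e (k, 1)))
      rw [← ha, ← hb, hJ, if_neg]
      rintro (rfl : a = b)
      have hcd : c ≠ d := by
        rintro rfl
        have := σ.injective (ha.symm.trans hb)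
        simp at this
      -- The swap of `0` and `c` is the permutation of `Fin 2` sending `0` to `c`, hence `1` to the
      -- other element `d`.
      refine hk ⟨a, Equiv.swap 0 c, fun x => ?_⟩
      have hd : d = Equiv.swap 0 c 1 := by
        clear ha hb
        revert c d; decide
      fin_cases x
      · simp [ha]
      · simpa [← hd] using hb.symm
  unfold pfaffian
  simp only [hterm]
  refine mul_ne_zero (inv_ne_zero (mul_ne_zero (by simp) (by simp [Nat.factorial_ne_zero]))) ?_
  rw [Finset.sum_boole, Nat.cast_ne_zero, Finset.card_ne_zero]
  exact ⟨1, Finset.mem_filter.mpr ⟨Finset.mem_univ _, fun k => ⟨k, 1, fun c => rfl⟩⟩⟩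

end Pfaffian

/-! ### The trace form on the two families -/

section LieAlg

theorem mem_lieAlg_gl {n : ℕ} (a : Mat n) : a ∈ lieAlg .gl n := LieSubalgebra.mem_top a

theorem mem_lieAlg_so {n : ℕ} {a : Mat n} : a ∈ lieAlg .so n ↔ a.transpose = -a :=
  LieAlgebra.Orthogonal.mem_so (Fin n) ℂ a

theorem sub_transpose_mem_so {n : ℕ} (a : Mat n) : a - a.transpose ∈ lieAlg .so n := by
  rw [mem_lieAlg_so]; simp

theorem exists_trace_mul_eq {n : ℕ} (φ : Mat n →ₗ[ℂ] ℂ) :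
    ∃ G : Mat n, ∀ v, φ v = (G * v).trace := by
  refine ⟨Matrix.of fun a b => φ (Matrix.single b a 1), fun v => ?_⟩
  conv_lhs => rw [Matrix.matrix_eq_sum_single v]
  simp only [map_sum, Matrix.trace, Matrix.diag, Matrix.mul_apply, Matrix.of_apply]
  rw [Finset.sum_comm]
  refine Finset.sum_congr rfl fun a _ => Finset.sum_congr rfl fun b _ => ?_
  rw [mul_comm, ← smul_eq_mul, ← map_smul, Matrix.smul_single, smul_eq_mul, mul_one]

theorem trace_transpose_mul_of_skew {n : ℕ} (G v : Mat n) (hv : v.transpose = -v) :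
    (G.transpose * v).trace = -(G * v).trace := by
  rw [← Matrix.trace_transpose, Matrix.transpose_mul, Matrix.transpose_transpose, hv,
    neg_mul, Matrix.trace_neg, Matrix.trace_mul_comm]

/-- Symmetric matrices are trace-orthogonal to skew ones, so for `so` only the skew part of a
representing matrix matters. -/
theorem exists_mem_trace_mul_eq (t : Family) {n : ℕ} (φ : Mat n →ₗ[ℂ] ℂ) :
    ∃ G ∈ lieAlg t n, ∀ v ∈ lieAlg t n, φ v = (G * v).trace := by
  obtain ⟨G, hG⟩ := exists_trace_mul_eq φ
  cases t with
  | gl => exact ⟨G, mem_lieAlg_gl G, fun v _ => hG v⟩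
  | so =>
    refine ⟨(2⁻¹ : ℂ) • (G - G.transpose), Submodule.smul_mem _ _ (sub_transpose_mem_so G),
      fun v hv => ?_⟩
    rw [smul_mul_assoc, Matrix.trace_smul, sub_mul, Matrix.trace_sub,
      trace_transpose_mul_of_skew _ _ (mem_lieAlg_so.mp hv), hG, smul_eq_mul]
    ring

/-- The trace form is nondegenerate on `𝔤ₙ`. -/
theorem eq_zero_of_trace_mul (t : Family) {n : ℕ} {ξ : Mat n} (hξ : ξ ∈ lieAlg t n)
    (h : ∀ a ∈ lieAlg t n, (a * ξ).trace = 0) : ξ = 0 := by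
  have h' : ∀ a : Mat n, (a * ξ).trace = 0 := by
    cases t with
    | gl => exact fun a => h a (mem_lieAlg_gl a)
    | so =>
      intro a
      have h1 := h _ (sub_transpose_mem_so a)
      rw [sub_mul, Matrix.trace_sub, trace_transpose_mul_of_skew _ _ (mem_lieAlg_so.mp hξ)] at h1
      linear_combination h1 / 2
  exact Matrix.ext_iff_trace_mul_left.mpr fun a => by rw [h' a, mul_zero, Matrix.trace_zero]

theorem trace_mul_lie' {n : ℕ} (G a y : Mat n) : (G * ⁅a, y⁆).trace = (a * ⁅y, G⁆).trace := by
  simp only [Ring.lie_def, mul_sub, Matrix.trace_sub]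
  rw [← mul_assoc G a y, Matrix.trace_mul_comm (G * a) y, ← mul_assoc y G a,
    Matrix.trace_mul_comm (y * G) a, ← mul_assoc G y a, Matrix.trace_mul_comm (G * y) a]

end LieAlg

/-! ### Derivatives of traces of powers and of the Pfaffian -/

section Calculus
open scoped Matrix.Norms.Operator

theorem contDiff_entry {n : ℕ} (i j : Fin n) {k : WithTop ℕ∞} :
    ContDiff ℂ k fun y : Mat n => y i j :=
  (LinearMap.toContinuousLinearMap (Matrix.entryLinearMap ℂ ℂ i j)).contDiff

theorem contDiff_trace {n : ℕ} {k : WithTop ℕ∞} : ContDiff ℂ k fun y : Mat n => y.trace :=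
  (LinearMap.toContinuousLinearMap (Matrix.traceLinearMap (Fin n) ℂ ℂ)).contDiff

theorem contDiff_pfaffian {n : ℕ} {k : WithTop ℕ∞} :
    ContDiff ℂ k fun y : Mat n => pfaffian y := by
  unfold pfaffian
  refine contDiff_const.mul (ContDiff.sum fun σ _ => contDiff_const.mul ?_)
  exact contDiff_prod fun i _ => contDiff_entry _ _

theorem contDiff_invariant (t : Family) (i : ℕ) (j : Fin (rank t i)) {k : WithTop ℕ∞} :
    ContDiff ℂ k (invariant t i j) := by
  cases t with
  | gl => exact contDiff_trace.comp (contDiff_id.pow _)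
  | so =>
    by_cases h : Even i ∧ j.1 + 1 = rank .so i
    · have e : invariant .so i j = fun y => pfaffian y := funext fun y => if_pos h
      rw [e]
      exact contDiff_pfaffian
    · have e : invariant .so i j = fun y => (y ^ (2 * (j.1 + 1))).trace :=
        funext fun y => if_neg h
      rw [e]
      exact contDiff_trace.comp (contDiff_id.pow _)

theorem hasDerivAt_trace_pow {n : ℕ} {γ : ℂ → Mat n} {v : Mat n} {s : ℂ}
    (h : HasDerivAt γ v s) (k : ℕ) :
    HasDerivAt (fun u => (γ u ^ (k + 1)).trace) ((k + 1 : ℂ) * (γ s ^ k * v).trace) s := by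
  have h1 := (LinearMap.toContinuousLinearMap
    (Matrix.traceLinearMap (Fin n) ℂ ℂ)).hasFDerivAt.comp_hasDerivAt s (h.fun_pow' (k + 1))
  refine h1.congr_deriv ?_
  change (∑ i ∈ Finset.range (k + 1), γ s ^ ((k + 1).pred - i) * v * γ s ^ i).trace = _
  rw [Matrix.trace_sum]
  rw [Finset.sum_congr rfl (g := fun _ => (γ s ^ k * v).trace)]
  · simp
  · intro i hi
    have hi := Finset.mem_range.mp hi
    rw [Matrix.trace_mul_comm, ← mul_assoc, ← pow_add]
    congr 3
    simp only [Nat.pred_succ]; omega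

theorem hasDerivAt_line {n : ℕ} (y v : Mat n) (s : ℂ) :
    HasDerivAt (fun u : ℂ => y + u • v) v s := by
  have h := ((hasDerivAt_id s).smul_const v).const_add y
  rw [one_smul] at h
  exact h

theorem fderiv_trace_pow {n : ℕ} (k : ℕ) (y v : Mat n) :
    fderiv ℂ (fun z : Mat n => (z ^ (k + 1)).trace) y v = (k + 1 : ℂ) * (y ^ k * v).trace := by
  have hd : Differentiable ℂ (fun z : Mat n => (z ^ (k + 1)).trace) :=
    (contDiff_trace.comp (contDiff_id.pow _)).differentiable one_ne_zero
  have h0 := hasDerivAt_line y v 0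
  have h1 := hasDerivAt_trace_pow h0 k
  have h2 := (hd (y + (0 : ℂ) • v)).hasFDerivAt.comp_hasDerivAt 0 h0
  have h3 := h2.unique h1
  rw [zero_smul, add_zero] at h3
  exact h3

theorem hasDerivAt_det_one_add_smul {n : ℕ} (a : Mat n) :
    HasDerivAt (fun s : ℂ => (1 + s • a).det) a.trace 0 := by
  -- This is the factor of `s²` in the expansion of the determinant; only its differentiability
  -- matters.
  set p := (1 + (Polynomial.X : Polynomial ℂ) • a.map Polynomial.C).det.divX.divX with hp
  rw [funext fun s => Matrix.det_one_add_smul s a, ← hp]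
  have h1 : HasDerivAt (fun s : ℂ => 1 + a.trace * s) a.trace 0 := by
    simpa using ((hasDerivAt_id (0 : ℂ)).const_mul a.trace).const_add 1
  have h2 := (p.hasDerivAt (0 : ℂ)).mul ((hasDerivAt_id (0 : ℂ)).pow 2)
  exact (h1.add h2).congr_deriv (by simp)

/-- Differentiate `Pf(g y gᵀ) = det g * Pf y` along `g = 1 + s a` at `s = 0`. -/
theorem fderiv_pfaffian {n : ℕ} (hn : Even n) (y a : Mat n) :
    fderiv ℂ (fun z : Mat n => pfaffian z) y (a * y + y * a.transpose)
      = a.trace * pfaffian y := by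
  have hd : Differentiable ℂ (fun z : Mat n => pfaffian z) :=
    contDiff_pfaffian.differentiable one_ne_zero
  have e : ∀ s : ℂ, (1 + s • a).transpose = 1 + s • a.transpose := by intro s; simp
  have h0 : HasDerivAt (fun s : ℂ => (1 + s • a) * y * (1 + s • a).transpose)
      (a * y + y * a.transpose) 0 := by
    simp only [e]
    have h := ((hasDerivAt_line 1 a 0).mul_const y).mul (hasDerivAt_line 1 a.transpose 0)
    simp only [zero_smul, add_zero, mul_one, one_mul] at h
    exact h
  have h1 : HasDerivAt (fun s : ℂ => pfaffian ((1 + s • a) * y * (1 + s • a).transpose))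
      (a.trace * pfaffian y) 0 := by
    simp only [pfaffian_conj hn]
    exact (hasDerivAt_det_one_add_smul a).mul_const _
  have h2 := (hd _).hasFDerivAt.comp_hasDerivAt 0 h0
  have h3 := h2.unique h1
  rw [zero_smul, add_zero, one_mul, Matrix.transpose_one, mul_one] at h3
  exact h3

/-- Testing `fderiv_pfaffian` against every `a` gives `tr(a) Pf(y) = 2 tr(a y G)`, because the two
summands of the tangent direction pair equally with the skew `G`. Invertibility of `y` is not
needed. -/
theorem mul_gradient_pfaffian {n : ℕ} (hn : Even n) {y G : Mat n} (hy : y.transpose = -y)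
    (hG : G.transpose = -G)
    (h : ∀ v ∈ lieAlg .so n, fderiv ℂ (fun z : Mat n => pfaffian z) y v = (G * v).trace) :
    y * G = (pfaffian y / 2) • (1 : Mat n) := by
  refine Matrix.ext_iff_trace_mul_left.mpr fun a => ?_
  have hs : a * y + y * a.transpose ∈ lieAlg .so n := by
    rw [mem_lieAlg_so]; simp [hy, add_comm]
  have h1 := h _ hs
  rw [fderiv_pfaffian hn, mul_add, Matrix.trace_add] at h1
  have h2 : (G * (y * a.transpose)).trace = (a * (y * G)).trace := by
    rw [← Matrix.trace_transpose]; simp [hy, hG, mul_assoc]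
  have h3 : (G * (a * y)).trace = (a * (y * G)).trace := by
    rw [Matrix.trace_mul_comm, mul_assoc]
  rw [h2, h3] at h1
  rw [mul_smul_comm, mul_one, Matrix.trace_smul, smul_eq_mul]
  linear_combination -h1 / 2

end Calculus

/-! ### Nonvanishing of the Pfaffian on invertible skew matrices -/

section PfaffianNonzero
open scoped Matrix.Norms.Operator
open Polynomial

/-- Compare orders of vanishing at `0`: differentiation lowers that of a nonzero `P` by one and `Q`
contributes nothing, while the right side vanishes at least to the order of `P`. -/
theorem polynomial_eq_zero_of_ode {P Q R : ℂ[X]} (h : 2 * Q * derivative P = P * R)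
    (hP : P.IsRoot 0) (hQ : ¬ Q.IsRoot 0) : P = 0 := by
  by_contra hP0
  have hQ0 : Q ≠ 0 := by rintro rfl; simp at hQ
  have hm : 1 ≤ P.rootMultiplicity 0 := (rootMultiplicity_pos hP0).mpr hP
  have hP' : derivative P ≠ 0 := by
    intro h0
    rw [eq_C_of_natDegree_eq_zero (derivative_eq_zero.mp h0)] at hP hP0
    simp only [IsRoot.def, eval_C] at hP
    simp [hP] at hP0
  have hne : Q * derivative P ≠ 0 := mul_ne_zero hQ0 hP'
  have hdvd : (X - C 0) ^ P.rootMultiplicity 0 ∣ Q * derivative P := by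
    have h2 : Q * derivative P = P * (C (1 / 2) * R) := by
      have : (C (1 / 2) * 2 : ℂ[X]) = 1 := by
        rw [← C_ofNat, ← C_mul]; norm_num
      linear_combination (C (1 / 2)) * h - Q * derivative P * this
    rw [h2]
    exact (pow_rootMultiplicity_dvd P 0).mul_right _
  have := (le_rootMultiplicity_iff hne).mpr hdvd
  rw [rootMultiplicity_mul hne, derivative_rootMultiplicity_of_root hP,
    rootMultiplicity_eq_zero hQ] at this
  omega

/-- The polynomial `X ↦ Pf(y + X z)`. -/
noncomputable def pfaffianLine {m : ℕ} (y z : Mat m) : ℂ[X] :=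
  C (((2 : ℂ) ^ (m / 2) * ((m / 2).factorial : ℂ))⁻¹) *
    ∑ σ : Equiv.Perm (Fin m), C ((Equiv.Perm.sign σ : ℤ) : ℂ) *
      ∏ k : Fin (m / 2), (C (y (σ ⟨2 * k.1, by omega⟩) (σ ⟨2 * k.1 + 1, by omega⟩)) +
        X * C (z (σ ⟨2 * k.1, by omega⟩) (σ ⟨2 * k.1 + 1, by omega⟩)))

theorem eval_pfaffianLine {m : ℕ} (y z : Mat m) (t : ℂ) :
    (pfaffianLine y z).eval t = pfaffian (y + t • z) := by
  simp [pfaffianLine, pfaffian, eval_finsetSum, eval_prod, mul_comm t]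

/-- On the line from `y` to the standard form, `P(t) = Pf(y + t z)` satisfies `2 det * P' = P *
tr(adj * z)`. This is the gradient identity multiplied by the adjugate, so it also holds where the
matrix is singular. If `P(0) = 0`, then `P` vanishes identically, contradicting its value at `t =
1`. -/
theorem pfaffian_ne_zero {m : ℕ} (hm : Even m) {y : Mat m} (hy : y.transpose = -y)
    (hu : IsUnit y) : pfaffian y ≠ 0 := by
  intro h0
  set z := stdSkew hm - y with hz
  have hzs : z.transpose = -z := by rw [hz, Matrix.transpose_sub, stdSkew_transpose, hy]; abel
  let N : Matrix (Fin m) (Fin m) ℂ[X] := y.map C + (X : ℂ[X]) • z.map C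
  have hN : ∀ t : ℂ, (evalRingHom t).mapMatrix N = y + t • z := by
    intro t; ext i j; simp [N, mul_comm t]
  have hdet : ∀ t, N.det.eval t = (y + t • z).det := by
    intro t; rw [← hN, ← RingHom.map_det]; rfl
  have hadj : ∀ t, (N.adjugate * z.map C).trace.eval t
      = ((y + t • z).adjugate * z).trace := by
    intro t
    have h1 : (evalRingHom t).mapMatrix (N.adjugate * z.map C) = (y + t • z).adjugate * z := by
      rw [map_mul, RingHom.map_adjugate, hN]
      congr 1
      ext i j; simp
    rw [← h1, Matrix.trace, Matrix.trace, eval_finsetSum]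
    rfl
  have hP : pfaffianLine y z = 0 := by
    refine polynomial_eq_zero_of_ode (Q := N.det) (R := (N.adjugate * z.map C).trace) ?_ ?_ ?_
    · refine Polynomial.funext fun t => ?_
      rw [eval_mul, eval_mul, eval_mul, hdet, hadj, eval_pfaffianLine, eval_ofNat]
      have hys : (y + t • z) ∈ lieAlg .so m := by
        rw [mem_lieAlg_so]; simp [hy, hzs]; abel
      obtain ⟨G, hG, hGv⟩ := exists_mem_trace_mul_eq .so
        (fderiv ℂ (fun w : Mat m => pfaffian w) (y + t • z)).toLinearMap
      have h1 := mul_gradient_pfaffian hm (mem_lieAlg_so.mp hys) (mem_lieAlg_so.mp hG) hGv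
      have h2 : (derivative (pfaffianLine y z)).eval t = (G * z).trace := by
        have hd : Differentiable ℂ (fun z : Mat m => pfaffian z) :=
          contDiff_pfaffian.differentiable one_ne_zero
        have e1 := (hd _).hasFDerivAt.comp_hasDerivAt t (hasDerivAt_line y z t)
        have e2 := (pfaffianLine y z).hasDerivAt t
        simp only [eval_pfaffianLine] at e2
        rw [← hGv z (mem_lieAlg_so.mpr hzs)]
        exact e2.unique e1
      have h3 : (y + t • z).det • G = (pfaffian (y + t • z) / 2) • (y + t • z).adjugate := by
        have := congrArg (fun w => (y + t • z).adjugate * w) h1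
        simpa [← mul_assoc, Matrix.adjugate_mul] using this
      have h4 := congrArg (fun w => (w * z).trace) h3
      simp only [smul_mul_assoc, Matrix.trace_smul, smul_eq_mul] at h4
      rw [h2]
      linear_combination 2 * h4
    · simpa [IsRoot.def, eval_pfaffianLine] using h0
    · rw [IsRoot.def, hdet]
      simpa using ((Matrix.isUnit_iff_isUnit_det y).mp hu).ne_zero
  have := eval_pfaffianLine y z 1
  rw [hP, one_smul, hz, add_sub_cancel, eval_zero] at this
  exact pfaffian_stdSkew_ne_zero hm this.symm

end PfaffianNonzero

/-! ### Regularity in `gl` of the cutoffs -/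

section RegularElements

theorem finrank_map_add_finrank_inf_ker {K V W : Type*} [Field K] [AddCommGroup V] [Module K V]
    [FiniteDimensional K V] [AddCommGroup W] [Module K W] (f : V →ₗ[K] W) (Z : Submodule K V) :
    Module.finrank K (Z.map f) + Module.finrank K (Z ⊓ LinearMap.ker f : Submodule K V)
      = Module.finrank K Z := by
  rw [← LinearMap.finrank_range_add_finrank_ker (f.domRestrict Z), LinearMap.range_domRestrict,
    LinearMap.ker_domRestrict, ← Submodule.map_comap_subtype, Submodule.finrank_map_subtype_eq]

theorem mem_centralizer {t : Family} {i : ℕ} {y z : Mat i} :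
    z ∈ centralizer t i y ↔ z ∈ lieAlg t i ∧ y * z = z * y := by
  rw [centralizer, Submodule.mem_inf, LinearMap.mem_ker, LieAlgebra.ad_apply, Ring.lie_def,
    sub_eq_zero]
  rfl

theorem mem_centralizer_gl {i : ℕ} {y z : Mat i} :
    z ∈ centralizer .gl i y ↔ y * z = z * y :=
  mem_centralizer.trans (and_iff_right (mem_lieAlg_gl z))

theorem exists_eigenbasis {i : ℕ} {y : Mat i}
    (hy : Module.End.IsSemisimple (Matrix.toLin' y)) :
    ∃ (P : Mat i) (d : Fin i → ℂ), IsUnit P ∧ y * P = P * Matrix.diagonal d := by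
  classical
  have hint := DirectSum.isInternal_submodule_of_iSupIndep_of_iSup_eq_top
    (Module.End.eigenspaces_iSupIndep (Matrix.toLin' y)) hy.iSup_eigenspace_eq_top
  let b := hint.collectedBasis fun μ => Module.finBasis ℂ (Module.End.eigenspace (Matrix.toLin' y) μ)
  let e := b.indexEquiv (Pi.basisFun ℂ (Fin i))
  let b' := b.reindex e
  refine ⟨Matrix.of fun k j => b' j k, fun j => (e.symm j).1, ?_, ?_⟩
  · rw [← Matrix.linearIndependent_cols_iff_isUnit]
    exact b'.linearIndependent
  · ext k j
    rw [Matrix.mul_diagonal]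
    have h := hint.collectedBasis_mem
      (fun μ => Module.finBasis ℂ (Module.End.eigenspace (Matrix.toLin' y) μ)) (e.symm j)
    rw [Module.End.mem_eigenspace_iff, Matrix.toLin'_apply] at h
    have h2 : b' j = b (e.symm j) := b.reindex_apply e j
    have := congrFun h k
    rw [Matrix.mul_apply]
    simp only [Matrix.of_apply, h2]
    exact this.trans (mul_comm _ _)

/-- If two diagonal entries coincide, the matrix unit at that position commutes with `diagonal d`
along with all diagonal matrices, and the centralizer has dimension at least `i + 1`. -/
theorem eigenvalues_injective {i : ℕ} {y P : Mat i} {d : Fin i → ℂ} (hP : IsUnit P)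
    (h : y * P = P * Matrix.diagonal d)
    (hd : Module.finrank ℂ (centralizer .gl i y) ≤ i) : Function.Injective d := by
  intro a b hab
  by_contra hne
  obtain ⟨Q, hPQ, hQP⟩ : ∃ Q, P * Q = 1 ∧ Q * P = 1 :=
    ⟨_, hP.unit.mul_inv, hP.unit.inv_mul⟩
  let D : ((Fin i → ℂ) × ℂ) →ₗ[ℂ] Mat i :=
    (Matrix.diagonalLinearMap (Fin i) ℂ ℂ).coprod
      (LinearMap.toSpanSingleton ℂ (Mat i) (Matrix.single a b 1))
  have hD : ∀ w, D w = Matrix.diagonal w.1 + w.2 • Matrix.single a b 1 := fun w => rfl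
  have hcomm : ∀ w, Matrix.diagonal d * D w = D w * Matrix.diagonal d := by
    intro w
    ext k l
    rw [Matrix.diagonal_mul, Matrix.mul_diagonal, hD, mul_comm]
    by_cases hkl : k = l
    · rw [hkl]
    · by_cases h2 : a = k ∧ b = l
      · rw [← h2.1, ← h2.2, hab]
      · simp [h2, hkl]
  let F : ((Fin i → ℂ) × ℂ) →ₗ[ℂ] Mat i :=
    (LinearMap.mulRight ℂ Q).comp ((LinearMap.mulLeft ℂ P).comp D)
  have hF : ∀ w, F w = P * D w * Q := fun w => rfl
  have hy : y = P * Matrix.diagonal d * Q := by rw [← h, mul_assoc, hPQ, mul_one]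
  have hFc : ∀ w, F w ∈ centralizer .gl i y := by
    intro w
    rw [mem_centralizer_gl, hF, hy]
    calc P * Matrix.diagonal d * Q * (P * D w * Q)
        = P * Matrix.diagonal d * (Q * P) * D w * Q := by simp only [mul_assoc]
      _ = P * D w * (Q * P) * Matrix.diagonal d * Q := by
          rw [hQP, mul_one, mul_one, mul_assoc P, hcomm, ← mul_assoc]
      _ = _ := by simp only [mul_assoc]
  have hinj : Function.Injective F := by
    rw [← LinearMap.ker_eq_bot, LinearMap.ker_eq_bot']
    intro w hw
    have h1 : D w = 0 := by
      calc D w = (Q * P) * D w * (Q * P) := by rw [hQP, one_mul, mul_one]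
        _ = Q * (P * D w * Q) * P := by simp only [mul_assoc]
        _ = 0 := by rw [← hF, hw, mul_zero, zero_mul]
    have h2 : ∀ k, w.1 k = 0 := by
      intro k
      have := congrFun (congrFun h1 k) k
      have hk : ¬ (a = k ∧ b = k) := fun h => hne (h.1.trans h.2.symm)
      simpa [hD, Matrix.single_apply, hk] using this
    have h3 : w.2 = 0 := by
      have := congrFun (congrFun h1 a) b
      simpa [hD, Matrix.single_apply, hne] using this
    exact Prod.ext (funext h2) h3
  have h4 := LinearMap.finrank_le_finrank_of_injective
    (f := F.codRestrict (centralizer .gl i y) hFc) (fun u v huv => hinj (congrArg Subtype.val huv))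
  rw [Module.finrank_prod, Module.finrank_fin_fun, Module.finrank_self] at h4
  omega

/-- In the eigenbasis a relation among the powers is a kernel vector of the Vandermonde matrix of
the eigenvalues. -/
theorem linearIndependent_pow_of_eigenbasis {i : ℕ} {y P : Mat i} {d : Fin i → ℂ} (hP : IsUnit P)
    (h : y * P = P * Matrix.diagonal d) (hd : Function.Injective d) :
    LinearIndependent ℂ fun k : Fin i => y ^ (k : ℕ) := by
  rw [Fintype.linearIndependent_iff]
  intro c hc
  have hpow : ∀ k : ℕ, y ^ k * P = P * Matrix.diagonal (d ^ k) := by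
    intro k
    rw [← Matrix.diagonal_pow]
    exact (SemiconjBy.pow_right (show SemiconjBy P (Matrix.diagonal d) y from h.symm) k).symm
  have h1 : P * Matrix.diagonal (fun a => ∑ k : Fin i, c k * d a ^ (k : ℕ)) = 0 := by
    have e : Matrix.diagonal (fun a => ∑ k : Fin i, c k * d a ^ (k : ℕ))
        = ∑ k : Fin i, c k • Matrix.diagonal (d ^ (k : ℕ)) := by
      ext a b
      by_cases hab : a = b
      · subst hab; simp [Matrix.sum_apply]
      · simp [Matrix.sum_apply, hab]
    rw [e, Finset.mul_sum]
    simp only [mul_smul_comm, ← hpow]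
    simp only [← smul_mul_assoc]
    rw [← Finset.sum_mul, hc, zero_mul]
  have h2 : Matrix.diagonal (fun a => ∑ k : Fin i, c k * d a ^ (k : ℕ)) = 0 :=
    hP.mul_right_eq_zero.mp h1
  have h3 : (Matrix.vandermonde d).mulVec c = 0 := by
    funext a
    have := congrFun (congrFun h2 a) a
    simpa [Matrix.mulVec, dotProduct, Matrix.vandermonde, mul_comm] using this
  have h4 := Matrix.eq_zero_of_mulVec_eq_zero (Matrix.det_vandermonde_ne_zero_iff.mpr hd) h3
  exact congrFun h4

theorem linearIndependent_pow {i : ℕ} {y : Mat i}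
    (hy : Module.End.IsSemisimple (Matrix.toLin' y))
    (hd : Module.finrank ℂ (centralizer .gl i y) ≤ i) :
    LinearIndependent ℂ fun k : Fin i => y ^ (k : ℕ) := by
  obtain ⟨P, d, hP, h⟩ := exists_eigenbasis hy
  exact linearIndependent_pow_of_eigenbasis hP h (eigenvalues_injective hP h hd)

theorem centralizer_gl_eq_span {i : ℕ} {y : Mat i}
    (hd : Module.finrank ℂ (centralizer .gl i y) ≤ i)
    (hli : LinearIndependent ℂ fun k : Fin i => y ^ (k : ℕ)) :
    centralizer .gl i y = Submodule.span ℂ (Set.range fun k : Fin i => y ^ (k : ℕ)) := by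
  symm
  refine Submodule.eq_of_le_of_finrank_le ?_ ?_
  · rw [Submodule.span_le]
    rintro _ ⟨k, rfl⟩
    exact mem_centralizer_gl.mpr ((Commute.refl y).pow_right k)
  · rw [finrank_span_eq_card hli, Fintype.card_fin]
    exact hd

/-- For skew-symmetric `y`, the centralizer in `gl` is bounded by twice the one in `so`, up to the
symmetric matrices annihilated by `y`. -/
theorem finrank_centralizer_gl_le {i : ℕ} {y : Mat i} (hy : y.transpose = -y) :
    ∃ S : Submodule ℂ (Mat i), (∀ z ∈ S, z.transpose = z ∧ y * z = 0) ∧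
      Module.finrank ℂ (centralizer .gl i y) ≤
        2 * Module.finrank ℂ (centralizer .so i y) + Module.finrank ℂ S := by
  -- Rank-nullity is used twice. `T` sends the `gl` centralizer into the `so` one, with symmetric
  -- kernel; multiplication by `y` sends commuting symmetric matrices into the `so` centralizer
  -- again, and its kernel there is `S`.
  let T : Mat i →ₗ[ℂ] Mat i :=
    LinearMap.id - (Matrix.transposeLinearEquiv (Fin i) (Fin i) ℂ ℂ).toLinearMap
  have hT : ∀ z, T z = z - z.transpose := fun z => rfl
  let L := LinearMap.mulLeft ℂ y
  have h1 := finrank_map_add_finrank_inf_ker T (centralizer .gl i y)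
  have h2 := finrank_map_add_finrank_inf_ker L (centralizer .gl i y ⊓ LinearMap.ker T)
  have hsym : ∀ z ∈ LinearMap.ker T, z.transpose = z := by
    intro z hz
    rw [LinearMap.mem_ker, hT, sub_eq_zero] at hz
    exact hz.symm
  have ht : ∀ z, y * z = z * y → y * z.transpose = z.transpose * y := by
    intro z hz
    have := congrArg Matrix.transpose hz
    rw [Matrix.transpose_mul, Matrix.transpose_mul, hy] at this
    simpa using this.symm
  refine ⟨centralizer .gl i y ⊓ LinearMap.ker T ⊓ LinearMap.ker L,
    fun z hz => ⟨hsym z hz.1.2, hz.2⟩, ?_⟩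
  have h3 : (centralizer .gl i y).map T ≤ centralizer .so i y := by
    rintro _ ⟨z, hz, rfl⟩
    have hz := mem_centralizer_gl.mp hz
    refine mem_centralizer.mpr ⟨sub_transpose_mem_so z, ?_⟩
    rw [hT, mul_sub, sub_mul, ht z hz, hz]
  have h4 : (centralizer .gl i y ⊓ LinearMap.ker T).map L ≤ centralizer .so i y := by
    rintro _ ⟨z, ⟨hz, hzT⟩, rfl⟩
    have hz := mem_centralizer_gl.mp hz
    refine mem_centralizer.mpr ⟨mem_lieAlg_so.mpr ?_, ?_⟩
    · change (y * z).transpose = -(y * z)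
      rw [Matrix.transpose_mul, hsym z hzT, hy, mul_neg, hz]
    · change y * (y * z) = y * z * y
      rw [mul_assoc, hz]
  have h5 := Submodule.finrank_mono h3
  have h6 := Submodule.finrank_mono h4
  omega

/-- All columns of `z` are multiples of one kernel vector `u`, and symmetry then forces `z` to be a
multiple of `u uᵀ`. -/
theorem finrank_symm_annihilated_le_one {i : ℕ} {y : Mat i}
    (hk : Module.finrank ℂ (LinearMap.ker (Matrix.toLin' y)) ≤ 1) (S : Submodule ℂ (Mat i))
    (hS : ∀ z ∈ S, z.transpose = z ∧ y * z = 0) : Module.finrank ℂ S ≤ 1 := by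
  obtain ⟨⟨u, hu⟩, hspan⟩ := finrank_le_one_iff.mp hk
  have hker : ∀ v, y.mulVec v = 0 → ∃ c : ℂ, c • u = v := by
    intro v hv
    obtain ⟨c, hc⟩ := hspan ⟨v, by rw [LinearMap.mem_ker, Matrix.toLin'_apply, hv]⟩
    exact ⟨c, congrArg Subtype.val hc⟩
  have hle : S ≤ Submodule.span ℂ {Matrix.vecMulVec u u} := by
    intro z hz
    obtain ⟨hzt, hyz⟩ := hS z hz
    have hcol : ∀ j, ∃ c : ℂ, c • u = fun k => z k j := by
      intro j
      refine hker _ (funext fun k => ?_)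
      exact congrFun (congrFun hyz k) j
    choose w hw using hcol
    have hz' : ∀ k j, z k j = w j * u k := fun k j => (congrFun (hw j) k).symm
    rw [Submodule.mem_span_singleton]
    by_cases hu0 : u = 0
    · refine ⟨0, ?_⟩
      ext k j
      simp [hz', hu0]
    · obtain ⟨k, hk⟩ := Function.ne_iff.mp hu0
      have hk : u k ≠ 0 := hk
      refine ⟨w k / u k, ?_⟩
      ext a j
      have h1 : w j * u k = w k * u j := by
        rw [← hz', ← hz', ← hzt, Matrix.transpose_apply, hzt]
      have h2 : w j = w k * u j / u k := by rw [← h1, mul_div_cancel_right₀ _ hk]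
      rw [hz', h2, Matrix.smul_apply, Matrix.vecMulVec_apply, smul_eq_mul]
      ring
  refine (Submodule.finrank_mono hle).trans ?_
  exact (finrank_span_le_card _).trans (by simp)

/-- With an invertible corner, a kernel vector is determined by its last coordinate. -/
theorem finrank_ker_le_one {m : ℕ} {y : Mat (m + 1)} (h : IsUnit (cutoff (Nat.le_succ m) y)) :
    Module.finrank ℂ (LinearMap.ker (Matrix.toLin' y)) ≤ 1 := by
  let f : LinearMap.ker (Matrix.toLin' y) →ₗ[ℂ] ℂ :=
    (LinearMap.proj (Fin.last m)).comp (Submodule.subtype _)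
  have hf : Function.Injective f := by
    rw [← LinearMap.ker_eq_bot, LinearMap.ker_eq_bot']
    rintro ⟨v, hv⟩ h0
    have h0 : v (Fin.last m) = 0 := h0
    rw [LinearMap.mem_ker, Matrix.toLin'_apply] at hv
    have h1 : (cutoff (Nat.le_succ m) y).mulVec (fun k => v k.castSucc) = 0 := by
      funext k
      have := congrFun hv k.castSucc
      rw [Matrix.mulVec, dotProduct, Fin.sum_univ_castSucc, h0, mul_zero, add_zero] at this
      exact this
    have h2 := Matrix.eq_zero_of_mulVec_eq_zero
      ((Matrix.isUnit_iff_isUnit_det _).mp h).ne_zero h1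
    refine Subtype.ext (funext fun k => ?_)
    induction k using Fin.lastCases with
    | last => exact h0
    | cast k => exact congrFun h2 k
  simpa using LinearMap.finrank_le_finrank_of_injective hf

theorem zero_mem_spectrum_of_odd {m : ℕ} (hm : Odd m) {y : Mat m} (hy : y.transpose = -y) :
    (0 : ℂ) ∈ spectrum ℂ y := by
  rw [spectrum.zero_mem_iff, Matrix.isUnit_iff_isUnit_det]
  have h := Matrix.det_transpose y
  rw [hy, Matrix.det_neg, Fintype.card_fin, hm.neg_one_pow] at h
  have : y.det = 0 := by linear_combination -h / 2
  simp [this]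

theorem cutoff_mem_lieAlg (t : Family) {n i : ℕ} (h : i ≤ n) {x : Mat n} (hx : x ∈ lieAlg t n) :
    cutoff h x ∈ lieAlg t i := by
  cases t with
  | gl => exact mem_lieAlg_gl _
  | so =>
    rw [mem_lieAlg_so] at hx ⊢
    rw [cutoff, Matrix.transpose_submatrix, hx]
    rfl

/-- The consequences of `x ∈ (𝔤ₙ)_Ω` for the cutoffs: `xᵢ` is regular in `gl(i)` and its powers
`1, xᵢ, …, xᵢⁱ⁻¹` are independent, and `xᵢ` is invertible if it lies in `so(i)` with `i` even. -/
structure IsStronglyRegularCutoff (t : Family) (i : ℕ) (y : Mat i) : Prop where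
  finrank_le : Module.finrank ℂ (centralizer .gl i y) ≤ i
  linearIndependent_pow : LinearIndependent ℂ fun k : Fin i => y ^ (k : ℕ)
  isUnit : t = .so → Even i → IsUnit y

theorem isStronglyRegularCutoff_of_le_one (t : Family) {i : ℕ} (hi : i ≤ 1) (y : Mat i) :
    IsStronglyRegularCutoff t i y := by
  have h : Module.finrank ℂ (centralizer .gl i y) ≤ i := by
    refine (Submodule.finrank_le _).trans ?_
    rw [Module.finrank_matrix, Fintype.card_fin, Module.finrank_self]
    interval_cases i <;> simp
  interval_cases i
  · exact ⟨h, linearIndependent_empty_type, fun _ _ => isUnit_of_subsingleton y⟩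
  · refine ⟨h, ?_, fun _ h1 => absurd h1 (by decide)⟩
    exact LinearIndependent.of_subsingleton 0 (by simp)

/-- In the `so` case, odd-size skew matrices have eigenvalue `0`. For even `i` disjointness makes
`xᵢ` invertible, so `S = 0` and the `gl` centralizer has dimension at most `2 (i/2) = i`. For odd
`i` it makes `xᵢ₋₁` invertible, so `xᵢ` has kernel of dimension at most one and the bound is `2
((i-1)/2) + 1 = i`. -/
theorem isStronglyRegularCutoff_of_omega {t : Family} {n : ℕ} {x : Mat n} (hx : x ∈ omegaSet t n)
    {i : ℕ} (hi : i ≤ n) : IsStronglyRegularCutoff t i (cutoff hi x) := by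
  rcases Nat.lt_or_ge 1 i with h1 | h1
  swap
  · exact isStronglyRegularCutoff_of_le_one t h1 _
  obtain ⟨hxg, hx⟩ := hx
  obtain ⟨⟨hreg, hss⟩, hdisj⟩ := hx i h1 hi
  have hu : t = .so → Even i → IsUnit (cutoff hi x) := by
    rintro rfl he
    have h0 := zero_mem_spectrum_of_odd (Nat.Even.sub_odd (by omega) he odd_one)
      (mem_lieAlg_so.mp (cutoff_mem_lieAlg .so ((Nat.sub_le i 1).trans hi) hxg))
    have := Set.disjoint_left.mp hdisj h0
    rwa [spectrum.zero_notMem_iff] at this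
  have hle : Module.finrank ℂ (centralizer .gl i (cutoff hi x)) ≤ i := by
    cases t with
    | gl => exact hreg.le
    | so =>
      have hskew := mem_lieAlg_so.mp (cutoff_mem_lieAlg .so hi hxg)
      obtain ⟨S, hS, hle⟩ := finrank_centralizer_gl_le hskew
      rw [hreg] at hle
      simp only [rank] at hle
      rcases Nat.even_or_odd i with he | ho
      · have : S = ⊥ := by
          rw [Submodule.eq_bot_iff]
          exact fun z hz => ((hu rfl he).mul_right_eq_zero).mp (hS z hz).2
        rw [this, finrank_bot] at hle
        omega
      · have h0 := zero_mem_spectrum_of_odd ho hskew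
        have hu' := Set.disjoint_right.mp hdisj h0
        rw [spectrum.zero_notMem_iff] at hu'
        obtain ⟨m, rfl⟩ : ∃ m, i = m + 1 := ⟨i - 1, by omega⟩
        have hk := finrank_ker_le_one (y := cutoff hi x) hu'
        have := finrank_symm_annihilated_le_one hk S hS
        obtain ⟨l, hl⟩ := ho
        omega
  exact ⟨hle, linearIndependent_pow hss hle, hu⟩

end RegularElements

/-! ### Dimension count -/

section Dimension

theorem finrank_so (n : ℕ) :
    Module.finrank ℂ (lieAlg .so n).toSubmodule = ∑ j ∈ Finset.range n, j := by
  let F : (lieAlg .so n).toSubmodule →ₗ[ℂ] ((Σ j : Fin n, Fin j.1) → ℂ) :=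
    { toFun := fun a p => a.1 (Fin.castLT p.2 (p.2.2.trans p.1.2)) p.1
      map_add' := fun _ _ => rfl
      map_smul' := fun _ _ => rfl }
  have hentry : ∀ a ∈ lieAlg .so n, ∀ i j, a j i = -a i j := fun a ha i j =>
    congrFun (congrFun (mem_lieAlg_so.mp ha) i) j
  have hF : Function.Bijective F := by
    constructor
    · rw [← LinearMap.ker_eq_bot, LinearMap.ker_eq_bot']
      rintro ⟨a, ha⟩ h
      have hlt : ∀ i j : Fin n, i < j → a i j = 0 := fun i j hij =>
        congrFun h (⟨j, ⟨i.1, hij⟩⟩ : Σ j : Fin n, Fin j.1)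
      refine Subtype.ext (Matrix.ext fun i j => ?_)
      rcases lt_trichotomy i j with hij | rfl | hij
      · exact hlt i j hij
      · have := hentry a ha i i
        exact self_eq_neg.mp this
      · have h1 := hentry a ha j i
        rw [hlt j i hij, neg_zero] at h1
        exact h1
    · intro f
      let a : Mat n := Matrix.of fun i j =>
        if h : i < j then f ⟨j, ⟨i.1, h⟩⟩ else if h : j < i then -f ⟨i, ⟨j.1, h⟩⟩ else 0
      refine ⟨⟨a, mem_lieAlg_so.mpr (Matrix.ext fun i j => ?_)⟩, funext fun p => ?_⟩
      · simp only [a, Matrix.transpose_apply, Matrix.neg_apply, Matrix.of_apply]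
        rcases lt_trichotomy i j with hij | rfl | hij
        · simp [hij, hij.not_gt]
        · simp
        · simp [hij, hij.not_gt]
      · have hp : Fin.castLT p.2 (p.2.2.trans p.1.2) < p.1 := p.2.2
        change a _ _ = f p
        simp only [a, Matrix.of_apply, dif_pos hp]
        rfl
  rw [(LinearEquiv.ofBijective F hF).finrank_eq, Module.finrank_fintype_fun_eq_card,
    Fintype.card_sigma]
  simp only [Fintype.card_fin]
  exact Fin.sum_univ_eq_sum_range (fun j => j) n

/-- Induction rests on `dim 𝔤ₙ₊₁ - dim 𝔤ₙ = rₙ + rₙ₊₁`: this is `2n + 1` for `gl` and `⌊n/2⌋ +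
⌊(n+1)/2⌋ = n` for `so`. -/
theorem finrank_lieAlg (t : Family) (n : ℕ) :
    Module.finrank ℂ (lieAlg t n).toSubmodule
      = rank t n + 2 * ∑ i ∈ Finset.range n, rank t i := by
  cases t with
  | gl =>
    have h : (lieAlg .gl n).toSubmodule = ⊤ := rfl
    rw [h, finrank_top, Module.finrank_matrix, Fintype.card_fin, Module.finrank_self, mul_one]
    induction n with
    | zero => simp [rank]
    | succ n ih =>
      have := ih rfl
      rw [Finset.sum_range_succ]
      simp only [rank] at this ⊢
      linarith
  | so =>
    rw [finrank_so]
    induction n with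
    | zero => simp [rank]
    | succ n ih =>
      rw [Finset.sum_range_succ, Finset.sum_range_succ, ih]
      simp only [rank]
      omega

theorem card_index (t : Family) (n : ℕ) :
    Fintype.card (Index t n) = ∑ i ∈ Finset.range n, rank t i := by
  rw [Fintype.card_sigma]
  simp only [Fintype.card_fin]
  rw [Finset.sum_coe_sort (Finset.Icc 1 (n - 1)) (fun i => rank t i)]
  refine Finset.sum_subset (fun i hi => ?_) (fun i hi hi' => ?_)
  · rw [Finset.mem_Icc] at hi
    rw [Finset.mem_range]; omega
  · rw [Finset.mem_range] at hi
    rw [Finset.mem_Icc] at hi'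
    have : i = 0 := by omega
    subst this
    cases t <;> rfl

theorem finrank_centralizer_of_le_one (t : Family) {n : ℕ} (hn : n ≤ 1) (x : Mat n) :
    Module.finrank ℂ (centralizer t n x) = rank t n := by
  cases t with
  | gl =>
    have h := isStronglyRegularCutoff_of_le_one .gl hn x
    rw [centralizer_gl_eq_span h.finrank_le h.linearIndependent_pow,
      finrank_span_eq_card h.linearIndependent_pow, Fintype.card_fin]
    rfl
  | so =>
    have h1 : Module.finrank ℂ (centralizer .so n x) ≤ _ :=
      Submodule.finrank_mono (inf_le_left (a := (lieAlg .so n).toSubmodule))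
    rw [finrank_so] at h1
    interval_cases n <;> simpa [rank] using h1

theorem finrank_centralizer_of_omega {t : Family} {n : ℕ} {x : Mat n} (hx : x ∈ omegaSet t n) :
    Module.finrank ℂ (centralizer t n x) = rank t n := by
  rcases Nat.lt_or_ge 1 n with h1 | h1
  · exact (hx.2 n h1 le_rfl).1.1
  · exact finrank_centralizer_of_le_one t h1 x

end Dimension

/-! ### Tangent spaces of the adjoint orbit -/

section Orbit
open scoped Matrix.Norms.Operator

/-- The matrix exponential as an invertible matrix. -/
noncomputable def expUnit {n : ℕ} (z : Mat n) : (Mat n)ˣ where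
  val := NormedSpace.exp z
  inv := NormedSpace.exp (-z)
  val_inv := by
    rw [← Matrix.exp_add_of_commute _ _ (Commute.refl z).neg_right, add_neg_cancel,
      NormedSpace.exp_zero]
  inv_val := by
    rw [← Matrix.exp_add_of_commute _ _ (Commute.refl z).neg_left, neg_add_cancel,
      NormedSpace.exp_zero]

theorem expUnit_mem {t : Family} {n : ℕ} {z : Mat n} (hz : z ∈ lieAlg t n) :
    expUnit z ∈ group t n :=
  Subgroup.subset_closure ⟨z, hz, rfl⟩

theorem transpose_of_mem_group {n : ℕ} {g : (Mat n)ˣ} (hg : g ∈ group .so n) :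
    (g : Mat n).transpose = ((g⁻¹ : (Mat n)ˣ) : Mat n) := by
  have : (g : Mat n).transpose * g = 1 := by
    induction hg using Subgroup.closure_induction with
    | mem g hg =>
      obtain ⟨z, hz, h⟩ := hg
      rw [h, ← Matrix.exp_transpose, mem_lieAlg_so.mp hz]
      exact (expUnit z).inv_val
    | one => simp
    | mul g h _ _ hg hh =>
      rw [Units.val_mul, Matrix.transpose_mul, mul_assoc, ← mul_assoc _ (g : Mat n), hg, one_mul, hh]
    | inv g _ hg =>
      have h1 : (g : Mat n).transpose = ((g⁻¹ : (Mat n)ˣ) : Mat n) :=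
        (Units.inv_eq_of_mul_eq_one_left hg).symm
      rw [← h1, Matrix.transpose_transpose, h1]
      exact g.mul_inv
  exact (Units.inv_eq_of_mul_eq_one_left this).symm

theorem conj_mem_lieAlg {t : Family} {n : ℕ} {g : (Mat n)ˣ} (hg : g ∈ group t n) {x : Mat n}
    (hx : x ∈ lieAlg t n) : (g : Mat n) * x * ((g⁻¹ : (Mat n)ˣ) : Mat n) ∈ lieAlg t n := by
  cases t with
  | gl => exact mem_lieAlg_gl _
  | so =>
    rw [mem_lieAlg_so] at hx ⊢
    rw [← transpose_of_mem_group hg, Matrix.transpose_mul, Matrix.transpose_mul,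
      Matrix.transpose_transpose, hx, neg_mul, mul_neg, mul_assoc]

theorem adjointOrbit_subset {t : Family} {n : ℕ} {x : Mat n} (hx : x ∈ lieAlg t n) :
    ∀ y ∈ adjointOrbit t n x, y ∈ lieAlg t n := by
  rintro _ ⟨g, hg, rfl⟩
  exact conj_mem_lieAlg hg hx

theorem conj_mem_adjointOrbit {t : Family} {n : ℕ} {x y : Mat n} (hy : y ∈ adjointOrbit t n x)
    {g : (Mat n)ˣ} (hg : g ∈ group t n) :
    (g : Mat n) * y * ((g⁻¹ : (Mat n)ˣ) : Mat n) ∈ adjointOrbit t n x := by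
  obtain ⟨h, hh, rfl⟩ := hy
  exact ⟨g * h, mul_mem hg hh, by simp [mul_assoc]⟩

theorem conj_pow {n : ℕ} (g : (Mat n)ˣ) (x : Mat n) (k : ℕ) :
    ((g : Mat n) * x * ((g⁻¹ : (Mat n)ˣ) : Mat n)) ^ k
      = (g : Mat n) * x ^ k * ((g⁻¹ : (Mat n)ˣ) : Mat n) :=
  Units.conj_pow g x k

theorem trace_conj {n : ℕ} (g : (Mat n)ˣ) (x : Mat n) :
    ((g : Mat n) * x * ((g⁻¹ : (Mat n)ˣ) : Mat n)).trace = x.trace := by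
  rw [Matrix.trace_mul_comm, ← mul_assoc, Units.inv_mul, one_mul]

theorem trace_pow_of_mem_orbit {t : Family} {n : ℕ} {x y : Mat n} (hy : y ∈ adjointOrbit t n x)
    (k : ℕ) : (y ^ k).trace = (x ^ k).trace := by
  obtain ⟨g, -, rfl⟩ := hy
  rw [conj_pow, trace_conj]

/-- Conjugation by an invertible matrix. -/
noncomputable def conjLinear {n : ℕ} (g : (Mat n)ˣ) : Mat n →ₗ[ℂ] Mat n :=
  (LinearMap.mulRight ℂ ((g⁻¹ : (Mat n)ˣ) : Mat n)).comp (LinearMap.mulLeft ℂ (g : Mat n))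

theorem conjLinear_apply {n : ℕ} (g : (Mat n)ˣ) (x : Mat n) :
    conjLinear g x = (g : Mat n) * x * ((g⁻¹ : (Mat n)ˣ) : Mat n) := rfl

theorem conjLinear_injective {n : ℕ} (g : (Mat n)ˣ) : Function.Injective (conjLinear g) := by
  intro a b h
  rw [conjLinear_apply, conjLinear_apply] at h
  exact g.mul_right_inj.mp ((g⁻¹).mul_left_inj.mp h)

theorem finrank_centralizer_conj_ge {t : Family} {n : ℕ} {x : Mat n} {g : (Mat n)ˣ}
    (hg : ∀ z ∈ lieAlg t n, conjLinear g z ∈ lieAlg t n) :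
    Module.finrank ℂ (centralizer t n x) ≤ Module.finrank ℂ (centralizer t n (conjLinear g x)) := by
  have hmap : (centralizer t n x).map (conjLinear g) ≤ centralizer t n (conjLinear g x) := by
    rintro _ ⟨z, hz, rfl⟩
    obtain ⟨hz1, hz2⟩ := mem_centralizer.mp hz
    refine mem_centralizer.mpr ⟨hg z hz1, ?_⟩
    have : ∀ a b : Mat n, conjLinear g a * conjLinear g b = conjLinear g (a * b) := by
      intro a b; simp [conjLinear_apply, mul_assoc]
    rw [this, this, hz2]
  refine le_trans (le_of_eq ?_) (Submodule.finrank_mono hmap)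
  exact (LinearEquiv.finrank_eq (Submodule.equivMapOfInjective _ (conjLinear_injective g) _))

theorem conjLinear_inv {n : ℕ} (g : (Mat n)ˣ) (x : Mat n) :
    conjLinear g⁻¹ (conjLinear g x) = x := by
  simp [conjLinear_apply, mul_assoc]

theorem finrank_centralizer_of_mem_orbit {t : Family} {n : ℕ} {x y : Mat n}
    (hx : x ∈ omegaSet t n) (hy : y ∈ adjointOrbit t n x) :
    Module.finrank ℂ (centralizer t n y) = rank t n := by
  rw [← finrank_centralizer_of_omega hx]
  obtain ⟨g, hg, rfl⟩ := hy
  refine le_antisymm ?_ (finrank_centralizer_conj_ge fun z hz => conj_mem_lieAlg hg hz)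
  have := finrank_centralizer_conj_ge (x := conjLinear g x) (g := g⁻¹)
    fun z hz => conj_mem_lieAlg (t := t) (inv_mem hg) hz
  rwa [conjLinear_inv] at this

theorem cutoff_self {n : ℕ} (x : Mat n) : cutoff le_rfl x = x := rfl

theorem centralizer_gl_of_mem_orbit {t : Family} {n : ℕ} {x y : Mat n}
    (hx : x ∈ omegaSet t n) (hy : y ∈ adjointOrbit t n x) :
    centralizer .gl n y = Submodule.span ℂ (Set.range fun k : Fin n => y ^ (k : ℕ)) := by
  have h := isStronglyRegularCutoff_of_omega hx le_rfl
  rw [cutoff_self] at h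
  obtain ⟨g, hg, rfl⟩ := hy
  refine centralizer_gl_eq_span ?_ ?_
  · have := finrank_centralizer_conj_ge (t := .gl) (x := conjLinear g x) (g := g⁻¹)
      fun z _ => mem_lieAlg_gl _
    rw [conjLinear_inv] at this
    exact this.trans h.finrank_le
  · have := h.linearIndependent_pow.map' (conjLinear g)
      (LinearMap.ker_eq_bot.mpr (conjLinear_injective g))
    have e : (fun k : Fin n => ((g : Mat n) * x * ((g⁻¹ : (Mat n)ˣ) : Mat n)) ^ (k : ℕ))
        = conjLinear g ∘ fun k : Fin n => x ^ (k : ℕ) := funext fun k => conj_pow g x k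
    rw [e]
    exact this

theorem hasDerivAt_expConj {n : ℕ} (a y : Mat n) :
    HasDerivAt (fun s : ℂ => NormedSpace.exp (s • a) * y * NormedSpace.exp (s • (-a)))
      ⁅a, y⁆ 0 := by
  have h := ((hasDerivAt_exp_smul_const a (0 : ℂ)).mul_const y).mul
    (hasDerivAt_exp_smul_const (-a) (0 : ℂ))
  simp only [zero_smul, NormedSpace.exp_zero, one_mul, mul_one] at h
  refine HasDerivAt.congr_deriv h ?_
  rw [Ring.lie_def, mul_neg, sub_eq_add_neg]

theorem differentiable_exp_smul {n : ℕ} (a : Mat n) :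
    Differentiable ℂ fun s : ℂ => NormedSpace.exp (s • a) :=
  fun s => (hasDerivAt_exp_smul_const a s).differentiableAt

theorem hasDerivAt_entry {n : ℕ} {γ : ℂ → Mat n} {v : Mat n} {s : ℂ} (h : HasDerivAt γ v s)
    (i j : Fin n) : HasDerivAt (fun u => γ u i j) (v i j) s :=
  (LinearMap.toContinuousLinearMap (Matrix.entryLinearMap ℂ ℂ i j)).hasFDerivAt.comp_hasDerivAt s h

theorem lie_mem_tangentSpace {t : Family} {n : ℕ} {x y : Mat n} (hy : y ∈ adjointOrbit t n x)
    {a : Mat n} (ha : a ∈ lieAlg t n) : ⁅a, y⁆ ∈ tangentSpace (adjointOrbit t n x) y := by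
  refine Submodule.subset_span
    ⟨fun s => NormedSpace.exp (s • a) * y * NormedSpace.exp (s • (-a)), by simp, ?_, ?_⟩
  · refine Filter.Eventually.of_forall fun s => ?_
    have := conj_mem_adjointOrbit hy (expUnit_mem ((lieAlg t n).toSubmodule.smul_mem s ha))
    simp only [smul_neg]
    exact this
  · intro i j
    refine ⟨?_, hasDerivAt_entry (hasDerivAt_expConj a y) i j⟩
    refine Differentiable.analyticAt (f := fun s : ℂ =>
      (NormedSpace.exp (s • a) * y * NormedSpace.exp (s • (-a))) i j) (fun s => ?_) 0
    have h := (((differentiable_exp_smul a) s).mul_const y).mul ((differentiable_exp_smul (-a)) s)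
    exact (hasDerivAt_entry h.hasDerivAt i j).differentiableAt

/-- The image of `ad y` is the trace-orthogonal complement of the centralizer: a functional
separating `v` from the image would be `tr(G ·)` with `G` commuting with `y`, hence a polynomial in
`y`, and so would kill `v`. -/
theorem mem_range_lie_of_trace {n : ℕ} {y v : Mat n}
    (hc : centralizer .gl n y = Submodule.span ℂ (Set.range fun k : Fin n => y ^ (k : ℕ)))
    (hv : ∀ k : ℕ, (y ^ k * v).trace = 0) : ∃ a : Mat n, ⁅a, y⁆ = v := by
  by_contra hcon
  have hnot : v ∉ LinearMap.range (LieAlgebra.ad ℂ (Mat n) y : Mat n →ₗ[ℂ] Mat n) := by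
    rintro ⟨a, ha⟩
    refine hcon ⟨-a, ?_⟩
    rw [← ha, LieAlgebra.ad_apply, neg_lie, lie_skew]
  obtain ⟨φ, hφv, hφ⟩ := Submodule.exists_dual_map_eq_bot_of_notMem hnot inferInstance
  obtain ⟨G, hG⟩ := exists_trace_mul_eq φ
  have h1 : ⁅y, G⁆ = 0 := by
    refine eq_zero_of_trace_mul .gl (mem_lieAlg_gl _) fun a _ => ?_
    rw [← trace_mul_lie', ← hG, ← lie_skew, map_neg, neg_eq_zero]
    have : φ ⁅y, a⁆ ∈ Submodule.map φ
        (LinearMap.range (LieAlgebra.ad ℂ (Mat n) y : Mat n →ₗ[ℂ] Mat n)) :=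
      Submodule.mem_map_of_mem ⟨a, rfl⟩
    rwa [hφ, Submodule.mem_bot] at this
  have h2 : G ∈ centralizer .gl n y := by
    rw [mem_centralizer_gl, ← sub_eq_zero]; exact h1
  rw [hc] at h2
  refine hφv ?_
  rw [hG]
  clear hG h1
  induction h2 using Submodule.span_induction with
  | mem z hz => obtain ⟨k, rfl⟩ := hz; exact hv k
  | zero => simp
  | add a b _ _ ha hb => rw [add_mul, Matrix.trace_add, ha, hb, add_zero]
  | smul c a _ ha => rw [smul_mul_assoc, Matrix.trace_smul, ha, smul_zero]

/-- For skew `y` and `v`, transposing `[a, y] = v` gives `[aᵀ, y] = -v`, so the skew part of `a`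
also solves the equation. -/
theorem mem_lie_range_of_mem {t : Family} {n : ℕ} {y v : Mat n} (hy : y ∈ lieAlg t n)
    (hv : v ∈ lieAlg t n) (h : ∃ a : Mat n, ⁅a, y⁆ = v) : ∃ a ∈ lieAlg t n, ⁅a, y⁆ = v := by
  obtain ⟨a, ha⟩ := h
  cases t with
  | gl => exact ⟨a, mem_lieAlg_gl a, ha⟩
  | so =>
    refine ⟨(2⁻¹ : ℂ) • (a - a.transpose), Submodule.smul_mem _ _ (sub_transpose_mem_so a), ?_⟩
    have h1 : ⁅a.transpose, y⁆ = -v := by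
      rw [← mem_lieAlg_so.mp hv, ← ha, Ring.lie_def, Ring.lie_def, Matrix.transpose_sub,
        Matrix.transpose_mul, Matrix.transpose_mul, mem_lieAlg_so.mp hy]
      simp only [neg_mul, mul_neg]
      abel
    rw [smul_lie, sub_lie, ha, h1, sub_neg_eq_add, ← two_smul ℂ v, smul_smul]
    norm_num

/-- The traces of powers are constant on the orbit, so a velocity satisfies `tr(yᵏ v) = 0` for all
`k`. This replaces any appeal to a manifold structure on the orbit. -/
theorem mem_tangentSpace_iff {t : Family} {n : ℕ} {x y : Mat n} (hx : x ∈ omegaSet t n)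
    (hy : y ∈ adjointOrbit t n x) {v : Mat n} :
    v ∈ tangentSpace (adjointOrbit t n x) y ↔ ∃ a ∈ lieAlg t n, ⁅a, y⁆ = v := by
  constructor
  · intro hv
    induction hv using Submodule.span_induction with
    | mem v hv =>
      obtain ⟨γ, h0, hM, hγ⟩ := hv
      have hd : HasDerivAt γ v 0 :=
        hasDerivAt_pi.2 fun i => hasDerivAt_pi.2 fun j => (hγ i j).2
      have hvg : v ∈ lieAlg t n := by
        cases t with
        | gl => exact mem_lieAlg_gl v
        | so =>
          rw [mem_lieAlg_so]
          ext i j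
          refine ((hγ j i).2.congr_of_eventuallyEq ?_).unique (hγ i j).2.neg
          filter_upwards [hM] with s hs
          have h1 := mem_lieAlg_so.mp (adjointOrbit_subset hx.1 _ hs)
          have h2 : γ s j i = - γ s i j := congrFun (congrFun h1 i) j
          exact h2.symm
      refine mem_lie_range_of_mem (adjointOrbit_subset hx.1 _ hy) hvg
        (mem_range_lie_of_trace (centralizer_gl_of_mem_orbit hx hy) fun k => ?_)
      have h1 := hasDerivAt_trace_pow hd k
      have h2 : HasDerivAt (fun u => (γ u ^ (k + 1)).trace) 0 0 := by
        refine (hasDerivAt_const (0 : ℂ) ((x ^ (k + 1)).trace)).congr_of_eventuallyEq ?_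
        filter_upwards [hM] with s hs
        exact trace_pow_of_mem_orbit hs _
      have h3 := h1.unique h2
      rw [h0] at h3
      exact (mul_eq_zero.mp h3).resolve_left (by exact_mod_cast Nat.succ_ne_zero k)
    | zero => exact ⟨0, zero_mem _, zero_lie y⟩
    | add u v _ _ hu hv =>
      obtain ⟨a, ha, rfl⟩ := hu
      obtain ⟨b, hb, rfl⟩ := hv
      exact ⟨a + b, add_mem ha hb, add_lie a b y⟩
    | smul c u _ hu =>
      obtain ⟨a, ha, rfl⟩ := hu
      exact ⟨c • a, (lieAlg t n).toSubmodule.smul_mem c ha, smul_lie c a y⟩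
  · rintro ⟨a, ha, rfl⟩
    exact lie_mem_tangentSpace hy ha

theorem finrank_tangentSpace {t : Family} {n : ℕ} {x y : Mat n} (hx : x ∈ omegaSet t n)
    (hy : y ∈ adjointOrbit t n x) :
    Module.finrank ℂ (tangentSpace (adjointOrbit t n x) y) = 2 * Fintype.card (Index t n) := by
  have h1 : tangentSpace (adjointOrbit t n x) y
      = (lieAlg t n).toSubmodule.map (LieAlgebra.ad ℂ (Mat n) y : Mat n →ₗ[ℂ] Mat n) := by
    ext v
    rw [mem_tangentSpace_iff hx hy, Submodule.mem_map]
    constructor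
    · rintro ⟨a, ha, rfl⟩
      exact ⟨-a, neg_mem ha, by rw [LieAlgebra.ad_apply, lie_neg, lie_skew]⟩
    · rintro ⟨a, ha, rfl⟩
      exact ⟨-a, neg_mem ha, by rw [LieAlgebra.ad_apply, neg_lie, lie_skew]⟩
  have h2 := finrank_map_add_finrank_inf_ker
    (LieAlgebra.ad ℂ (Mat n) y : Mat n →ₗ[ℂ] Mat n) (lieAlg t n).toSubmodule
  rw [← h1, finrank_lieAlg] at h2
  have h3 := finrank_centralizer_of_mem_orbit hx hy
  rw [centralizer] at h3
  rw [h3] at h2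
  rw [card_index]
  omega

end Orbit

/-! ### Hamiltonian vectors from gradients -/

section Hamiltonian
open scoped Matrix.Norms.Operator

theorem lie_mem_lieAlg {t : Family} {n : ℕ} {a b : Mat n} (ha : a ∈ lieAlg t n)
    (hb : b ∈ lieAlg t n) : ⁅a, b⁆ ∈ lieAlg t n := (lieAlg t n).lie_mem ha hb

theorem differential_apply {n : ℕ} (M : Set (Mat n)) {f : Mat n → ℂ} (hf : Differentiable ℂ f)
    (y : Mat n) (v : tangentSpace M y) : differential M f y v = fderiv ℂ f y v :=
  (hf y).lineDeriv_eq_fderiv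

/-- On `[a, y]` the differential is `tr(a [y, G])` and the form against `[b, y]` is `tr(a [b, y])`;
nondegeneracy of the trace form identifies the two brackets. -/
theorem isHamiltonianVector_iff {t : Family} {n : ℕ} {x y : Mat n} (hx : x ∈ omegaSet t n)
    (hy : y ∈ adjointOrbit t n x) {f : Mat n → ℂ} (hf : Differentiable ℂ f) {G : Mat n}
    (hG : G ∈ lieAlg t n) (hGv : ∀ v ∈ lieAlg t n, fderiv ℂ f y v = (G * v).trace) (ξ : Mat n) :
    IsHamiltonianVector (adjointOrbit t n x) (kks t n) f y ξ ↔ ξ = ⁅y, G⁆ := by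
  have hyg := adjointOrbit_subset hx.1 _ hy
  constructor
  · rintro ⟨hξ, h⟩
    obtain ⟨b, hb, rfl⟩ := (mem_tangentSpace_iff hx hy).mp hξ
    rw [← sub_eq_zero]
    refine eq_zero_of_trace_mul t (sub_mem (lie_mem_lieAlg hb hyg) (lie_mem_lieAlg hyg hG))
      fun a ha => ?_
    have h1 := h ⟨⁅a, y⁆, lie_mem_tangentSpace hy ha⟩
    rw [differential_apply _ hf, hGv _ (lie_mem_lieAlg ha hyg), kks_apply t n y a b ha hb,
      trace_mul_lie' G, trace_mul_lie' y] at h1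
    rw [mul_sub, Matrix.trace_sub, h1, sub_self]
  · rintro rfl
    have e : ⁅y, G⁆ = ⁅-G, y⁆ := by rw [neg_lie, lie_skew]
    refine ⟨(mem_tangentSpace_iff hx hy).mpr ⟨-G, neg_mem hG, e.symm⟩, ?_⟩
    rintro ⟨v, hv⟩
    obtain ⟨a, ha, rfl⟩ := (mem_tangentSpace_iff hx hy).mp hv
    rw [differential_apply _ hf, hGv _ (lie_mem_lieAlg ha hyg), e,
      kks_apply t n y a (-G) ha (neg_mem hG), trace_mul_lie' G, trace_mul_lie' y, ← e]

end Hamiltonian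

/-! ### Extension by zeros and nested corners -/

section Resize

/-- The matrix of size `n` with the same entries as `A`, cut off or extended by zeros. -/
def resize {m : ℕ} (n : ℕ) (A : Mat m) : Mat n := Matrix.of fun a b =>
  if h : a.1 < m ∧ b.1 < m then A ⟨a.1, h.1⟩ ⟨b.1, h.2⟩ else 0

theorem resize_apply {m n : ℕ} (A : Mat m) (a b : Fin n) (h : a.1 < m ∧ b.1 < m) :
    resize n A a b = A ⟨a.1, h.1⟩ ⟨b.1, h.2⟩ := dif_pos h

theorem resize_apply_eq_zero {m n : ℕ} (A : Mat m) (a b : Fin n) (h : ¬ (a.1 < m ∧ b.1 < m)) :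
    resize n A a b = 0 := dif_neg h

theorem resize_castLE {m n : ℕ} (h : m ≤ n) (A : Mat m) (a b : Fin m) :
    resize n A (Fin.castLE h a) (Fin.castLE h b) = A a b := resize_apply _ _ _ ⟨a.2, b.2⟩

/-- `resize` as a linear map. -/
def resizeLinear (m n : ℕ) : Mat m →ₗ[ℂ] Mat n where
  toFun := resize n
  map_add' A B := by
    ext a b
    simp only [resize, Matrix.of_apply, Matrix.add_apply]
    split_ifs <;> simp
  map_smul' c A := by
    ext a b
    simp only [resize, Matrix.of_apply, Matrix.smul_apply, RingHom.id_apply]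
    split_ifs <;> simp

/-- `cutoff` as a linear map. -/
def cutoffLinear {i n : ℕ} (h : i ≤ n) : Mat n →ₗ[ℂ] Mat i where
  toFun := cutoff h
  map_add' _ _ := rfl
  map_smul' _ _ := rfl

theorem sum_eq_sum_castLE {m n : ℕ} (h : m ≤ n) (f : Fin n → ℂ)
    (hf : ∀ a : Fin n, m ≤ a.1 → f a = 0) : ∑ a, f a = ∑ a : Fin m, f (Fin.castLE h a) := by
  symm
  refine Fintype.sum_of_injective _ (Fin.castLE_injective h) _ _ (fun a ha => ?_) fun _ => rfl
  refine hf a (not_lt.mp fun hlt => ha ⟨⟨a.1, hlt⟩, rfl⟩)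

/-- Extension by zeros is adjoint to the cutoff for the trace forms, so it carries gradients on a
corner to gradients on the full matrix. -/
theorem trace_resize_mul {m n : ℕ} (h : m ≤ n) (A : Mat m) (v : Mat n) :
    (resize n A * v).trace = (A * cutoff h v).trace := by
  simp only [Matrix.trace, Matrix.diag, Matrix.mul_apply]
  rw [sum_eq_sum_castLE h]
  · refine Finset.sum_congr rfl fun a _ => ?_
    rw [sum_eq_sum_castLE h]
    · simp only [resize_castLE]
      rfl
    · intro b hb
      rw [resize_apply_eq_zero _ _ _ (by omega), zero_mul]
  · intro a ha
    refine Finset.sum_eq_zero fun b _ => ?_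
    rw [resize_apply_eq_zero _ _ _ (by omega), zero_mul]

theorem resize_mul {m n : ℕ} (h : m ≤ n) (A B : Mat m) :
    resize n (A * B) = resize n A * resize n B := by
  ext a b
  rw [Matrix.mul_apply, sum_eq_sum_castLE h]
  · by_cases hab : a.1 < m ∧ b.1 < m
    · rw [resize_apply _ _ _ hab, Matrix.mul_apply]
      refine Finset.sum_congr rfl fun c _ => ?_
      have e1 : resize n A a (Fin.castLE h c) = A ⟨a.1, hab.1⟩ c :=
        resize_apply A a (Fin.castLE h c) ⟨hab.1, c.2⟩
      have e2 : resize n B (Fin.castLE h c) b = B c ⟨b.1, hab.2⟩ :=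
        resize_apply B (Fin.castLE h c) b ⟨c.2, hab.2⟩
      rw [e1, e2]
    · rw [resize_apply_eq_zero _ _ _ hab]
      symm
      refine Finset.sum_eq_zero fun c _ => ?_
      by_cases ha : a.1 < m
      · rw [resize_apply_eq_zero _ _ b (by omega), mul_zero]
      · rw [resize_apply_eq_zero _ a _ (by omega), zero_mul]
  · intro c hc
    rw [resize_apply_eq_zero _ _ _ (by omega), zero_mul]

theorem resize_resize {l m n : ℕ} (h : l ≤ m) (A : Mat l) :
    resize n (resize m A) = resize n A := by
  ext a b
  by_cases hab : a.1 < l ∧ b.1 < l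
  · rw [resize_apply _ _ _ hab, resize_apply _ _ _ ⟨by omega, by omega⟩]
    exact resize_apply A _ _ hab
  · rw [resize_apply_eq_zero _ _ _ hab]
    by_cases hab' : a.1 < m ∧ b.1 < m
    · rw [resize_apply _ _ _ hab']
      exact resize_apply_eq_zero A _ _ hab
    · rw [resize_apply_eq_zero _ _ _ hab']

theorem resize_injective {m n : ℕ} (h : m ≤ n) : Function.Injective (resize (m := m) n) := by
  intro A B hAB
  ext a b
  rw [← resize_castLE h A, hAB, resize_castLE]

theorem resize_mem_lieAlg (t : Family) {m n : ℕ} {A : Mat m} (hA : A ∈ lieAlg t m) :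
    resize n A ∈ lieAlg t n := by
  cases t with
  | gl => exact mem_lieAlg_gl _
  | so =>
    rw [mem_lieAlg_so] at hA ⊢
    ext a b
    rw [Matrix.transpose_apply, Matrix.neg_apply]
    by_cases hab : a.1 < m ∧ b.1 < m
    · rw [resize_apply _ _ _ hab, resize_apply _ _ _ hab.symm]
      exact congrFun (congrFun hA _) _
    · rw [resize_apply_eq_zero _ _ _ hab, resize_apply_eq_zero _ _ _ (by omega), neg_zero]

/-- Gradients of invariants of two nested corners pair to zero. -/
theorem trace_mul_lie_resize_eq_zero {n i j : ℕ} (hij : i ≤ j) (hj : j ≤ n) (y : Mat n) (A : Mat i)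
    {B : Mat j} (hB : Commute B (cutoff hj y)) :
    (y * ⁅resize n A, resize n B⁆).trace = 0 := by
  -- Both matrices live in the corner of size `j`, so the trace only sees `yⱼ`, which commutes with
  -- `B`.
  rw [← resize_resize hij A, Ring.lie_def, ← resize_mul hj, ← resize_mul hj]
  have e : resize n (resize j A * B) - resize n (B * resize j A)
      = resize n (resize j A * B - B * resize j A) := (map_sub (resizeLinear j n) _ _).symm
  rw [e, Matrix.trace_mul_comm, trace_resize_mul hj, sub_mul, Matrix.trace_sub, mul_assoc, hB.eq,
    mul_assoc B, Matrix.trace_mul_comm B, mul_assoc (resize j A), sub_self]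

end Resize

/-! ### Independence of the centralizers of the cutoffs -/

section Independence

/-- Apply the characteristic polynomial of `b` to both sides: Cayley-Hamilton kills the right, while
on the left its value at `a` is invertible because no eigenvalue of `a` is a root. -/
theorem eq_zero_of_intertwine {p q : ℕ} {a : Mat p} {b : Mat q}
    {T : Matrix (Fin p) (Fin q) ℂ} (h : a * T = T * b)
    (hd : Disjoint (spectrum ℂ b) (spectrum ℂ a)) : T = 0 := by
  have hpow : ∀ f : Polynomial ℂ, Polynomial.aeval a f * T = T * Polynomial.aeval b f := by
    intro f
    induction f using Polynomial.induction_on' with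
    | add f g hf hg => rw [map_add, map_add, Matrix.add_mul, Matrix.mul_add, hf, hg]
    | monomial k c =>
      have hk : a ^ k * T = T * b ^ k := by
        induction k with
        | zero => simp
        | succ k ih => rw [pow_succ', Matrix.mul_assoc, ih, ← Matrix.mul_assoc, h, Matrix.mul_assoc,
            pow_succ']
      rw [Polynomial.aeval_monomial, Polynomial.aeval_monomial, ← Algebra.smul_def,
        ← Algebra.smul_def, Matrix.smul_mul, Matrix.mul_smul, hk]
  have hu : IsUnit (Polynomial.aeval a b.charpoly) := by
    rcases p.eq_zero_or_pos with rfl | hp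
    · exact isUnit_of_subsingleton _
    have : Nonempty (Fin p) := ⟨⟨0, hp⟩⟩
    by_contra hn
    rw [← spectrum.zero_mem_iff ℂ,
      spectrum.map_polynomial_aeval_of_nonempty _ _
        (spectrum.nonempty_of_isAlgClosed_of_finiteDimensional ℂ a)] at hn
    obtain ⟨μ, hμ, h0⟩ := hn
    refine Set.disjoint_left.mp hd ?_ hμ
    rw [Matrix.mem_spectrum_iff_isRoot_charpoly]
    exact h0
  have h1 := hpow b.charpoly
  rw [Matrix.aeval_self_charpoly, Matrix.mul_zero] at h1
  obtain ⟨u, hu⟩ := hu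
  rw [← hu] at h1
  calc T = ((u⁻¹ : (Mat p)ˣ) : Mat p) * ((u : Mat p) * T) := by
        rw [← Matrix.mul_assoc, Units.inv_mul, Matrix.one_mul]
    _ = 0 := by rw [h1, Matrix.mul_zero]

/-- Since the last column of `Z` vanishes, the last row of `y` drops out of `Z * y`. The remaining
columns of `Z` therefore intertwine `y` with its corner. -/
theorem eq_zero_of_commute_of_last {m : ℕ} {y Z : Mat (m + 1)} (hc : y * Z = Z * y)
    (hlast : ∀ a, Z a (Fin.last m) = 0)
    (hd : Disjoint (spectrum ℂ (cutoff (Nat.le_succ m) y)) (spectrum ℂ y)) : Z = 0 := by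
  have h0 : Z.submatrix id (Fin.castLE (Nat.le_succ m)) = 0 := by
    refine eq_zero_of_intertwine (a := y) (b := cutoff (Nat.le_succ m) y) ?_ hd
    ext a b
    have h1 := congrFun (congrFun hc a) (Fin.castLE (Nat.le_succ m) b)
    rw [Matrix.mul_apply, Matrix.mul_apply, Fin.sum_univ_castSucc
      (fun j => Z a j * y j (Fin.castLE (Nat.le_succ m) b)), hlast, zero_mul, add_zero] at h1
    exact h1
  ext a b
  induction b using Fin.lastCases with
  | last => exact hlast a
  | cast b => exact congrFun (congrFun h0 a) b

/-- The centralizers of the cutoffs of an element of `(𝔤ₙ)_Ω` are independent. -/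
theorem eq_zero_of_sum_resize {n : ℕ} {x : Mat n}
    (hx : ∀ (i : ℕ) (_ : 2 ≤ i) (hi : i ≤ n),
      Disjoint (spectrum ℂ (cutoff ((Nat.sub_le i 1).trans hi) x)) (spectrum ℂ (cutoff hi x)))
    (Z : (i : ℕ) → Mat i) (m : ℕ) (hm : m ≤ n)
    (hZ : ∀ i (hi : i ≤ m), Commute (Z i) (cutoff (hi.trans hm) x))
    (hsum : ∑ i ∈ Finset.Icc 1 m, resize n (Z i) = 0) : ∀ i ∈ Finset.Icc 1 m, Z i = 0 := by
  induction m with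
  | zero => simp
  | succ m ih =>
    rw [Finset.sum_Icc_succ_top (by omega)] at hsum
    -- Only the summand of size `m + 1` reaches column `m`.
    have hlast : m ≠ 0 → ∀ a, Z (m + 1) a (Fin.last m) = 0 := by
      intro _ a
      have h1 := congrFun (congrFun hsum (Fin.castLE hm a)) (Fin.castLE hm (Fin.last m))
      rw [Matrix.add_apply, Matrix.sum_apply, Finset.sum_eq_zero, resize_castLE, zero_add] at h1
      · exact h1
      · intro i hi
        rw [Finset.mem_Icc] at hi
        refine resize_apply_eq_zero _ _ _ ?_
        simp only [Fin.val_castLE, Fin.val_last]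
        omega
    have htop : Z (m + 1) = 0 := by
      -- At size one there is no spectral condition, but the sum then has a single term.
      rcases Nat.eq_zero_or_pos m with rfl | hpos
      · refine resize_injective hm ?_
        simpa [show resize n (0 : Mat 1) = 0 from map_zero (resizeLinear 1 n)] using hsum
      · refine eq_zero_of_commute_of_last (hZ (m + 1) le_rfl).symm (hlast (by omega)) ?_
        exact hx (m + 1) (by omega) hm
    rw [htop, show resize n (0 : Mat (m + 1)) = 0 from map_zero (resizeLinear (m + 1) n),
      add_zero] at hsum
    intro i hi
    rw [Finset.mem_Icc] at hi
    rcases Nat.lt_or_ge m i with h | h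
    · obtain rfl : i = m + 1 := by omega
      exact htop
    · exact ih (by omega) (fun i hi => hZ i (by omega)) hsum i (Finset.mem_Icc.mpr ⟨hi.1, h⟩)

end Independence

/-! ### Gradients of the generating invariants -/

section Gradient
open scoped Matrix.Norms.Operator

/-- The exponent `e` such that the gradient of an invariant at `y`, for `so` multiplied by `y`, is a
multiple of `yᵉ`. -/
def gradientExponent (t : Family) (i : ℕ) (j : Fin (rank t i)) : ℕ :=
  match t with
  | .gl => j.1
  | .so => if Even i ∧ j.1 + 1 = rank .so i then 0 else 2 * j.1 + 2

/-- For `so(2l)` the trace invariants stop at `j = l - 2`, with exponent `2l - 2`; for `so(2l+1)`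
they reach `j = l - 1`, with exponent `2l`. -/
theorem gradientExponent_lt (t : Family) (i : ℕ) (j : Fin (rank t i)) :
    gradientExponent t i j < i := by
  cases t with
  | gl => exact j.2
  | so =>
    have hj : j.1 < i / 2 := j.2
    by_cases h : Even i ∧ j.1 + 1 = rank .so i
    · rw [show gradientExponent .so i j = 0 from if_pos h]
      omega
    · rw [show gradientExponent .so i j = 2 * j.1 + 2 from if_neg h]
      rcases Nat.even_or_odd i with he | ho
      · have : j.1 + 1 ≠ i / 2 := fun h' => h ⟨he, h'⟩
        omega
      · obtain ⟨k, hk⟩ := ho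
        omega

theorem gradientExponent_injective (t : Family) (i : ℕ) :
    Function.Injective (gradientExponent t i) := by
  intro j k h
  cases t with
  | gl => exact Fin.ext h
  | so =>
    unfold gradientExponent at h
    simp only at h
    refine Fin.ext ?_
    split_ifs at h <;> omega

/-- The factor by which the gradients of the invariants are multiplied to get powers of `y`. -/
def gradientFactor (t : Family) {i : ℕ} (y : Mat i) : Mat i :=
  match t with
  | .gl => 1
  | .so => y

/-- Traces of powers have multiples of powers of `y` as gradients, odd powers for `so`, hence skew.
The Pfaffian gradient need not be given as a power of `y`, but its product with `y` is scalar. Only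
there does `κ ≠ 0` use invertibility. -/
theorem exists_gradient (t : Family) {i : ℕ} (j : Fin (rank t i)) {y : Mat i}
    (hy : y ∈ lieAlg t i) :
    ∃ G ∈ lieAlg t i, (∀ v ∈ lieAlg t i, fderiv ℂ (invariant t i j) y v = (G * v).trace) ∧
      Commute G y ∧ ∃ κ : ℂ, gradientFactor t y * G = κ • y ^ gradientExponent t i j ∧
        ((t = .so → Even i → IsUnit y) → κ ≠ 0) := by
  cases t with
  | gl =>
    refine ⟨(j.1 + 1 : ℂ) • y ^ j.1, mem_lieAlg_gl _, fun v _ => ?_,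
      ((Commute.refl y).pow_left _).smul_left _, j.1 + 1, one_mul _,
      fun _ => Nat.cast_add_one_ne_zero _⟩
    rw [smul_mul_assoc, Matrix.trace_smul, smul_eq_mul]
    exact fderiv_trace_pow j.1 y v
  | so =>
    by_cases h : Even i ∧ j.1 + 1 = rank .so i
    · have e : invariant .so i j = fun z => pfaffian z := funext fun z => if_pos h
      obtain ⟨G, hG, hGv⟩ := exists_mem_trace_mul_eq .so
        (fderiv ℂ (fun z : Mat i => pfaffian z) y).toLinearMap
      have h1 := mul_gradient_pfaffian h.1 (mem_lieAlg_so.mp hy) (mem_lieAlg_so.mp hG) hGv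
      refine ⟨G, hG, ?_, ?_, pfaffian y / 2, ?_, fun hu => ?_⟩
      · rw [e]; exact hGv
      · have h2 := congrArg Matrix.transpose h1
        rw [Matrix.transpose_mul, mem_lieAlg_so.mp hy, mem_lieAlg_so.mp hG, neg_mul_neg,
          Matrix.transpose_smul, Matrix.transpose_one, ← h1] at h2
        exact h2
      · rw [show gradientExponent .so i j = 0 from if_pos h, pow_zero]
        exact h1
      · exact div_ne_zero (pfaffian_ne_zero h.1 (mem_lieAlg_so.mp hy) (hu rfl h.1)) two_ne_zero
    · have e : invariant .so i j = fun z => (z ^ (2 * j.1 + 1 + 1)).trace :=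
        funext fun z => if_neg h
      refine ⟨((2 * j.1 + 1 : ℕ) + 1 : ℂ) • y ^ (2 * j.1 + 1), Submodule.smul_mem _ _ ?_,
        fun v _ => ?_, ((Commute.refl y).pow_left _).smul_left _, (2 * j.1 + 1 : ℕ) + 1, ?_,
        fun _ => Nat.cast_add_one_ne_zero _⟩
      · change _ ∈ lieAlg .so i
        rw [mem_lieAlg_so, Matrix.transpose_pow, mem_lieAlg_so.mp hy, Odd.neg_pow ⟨_, rfl⟩]
      · rw [smul_mul_assoc, Matrix.trace_smul, smul_eq_mul, e]
        exact fderiv_trace_pow (2 * j.1 + 1) y v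
      · rw [show gradientExponent .so i j = 2 * j.1 + 2 from if_neg h]
        change y * _ = _
        rw [mul_smul_comm, ← pow_succ']

theorem linearIndependent_of_mul_eq_pow {i : ℕ} {ι : Type*} [Finite ι] {y B : Mat i}
    {G : ι → Mat i} {κ : ι → ℂ} {e : ι → ℕ}
    (hli : LinearIndependent ℂ fun k : Fin i => y ^ (k : ℕ)) (hlt : ∀ j, e j < i)
    (he : Function.Injective e) (hκ : ∀ j, κ j ≠ 0) (h : ∀ j, B * G j = κ j • y ^ e j) :
    LinearIndependent ℂ G := by
  have h1 : LinearIndependent ℂ fun j => y ^ e j :=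
    hli.comp (fun j => (⟨e j, hlt j⟩ : Fin i)) fun a b hab => he (congrArg Fin.val hab)
  have h2 := h1.units_smul fun j => Units.mk0 (κ j) (hκ j)
  refine LinearIndependent.of_comp (LinearMap.mulLeft ℂ B) ?_
  have h3 : LinearMap.mulLeft ℂ B ∘ G = (fun j => Units.mk0 (κ j) (hκ j)) • fun j => y ^ e j :=
    funext fun j => h j
  rw [h3]
  exact h2

end Gradient

/-! ### The Gelfand-Zeitlin functions at a point of `(𝔤ₙ)_Ω` -/

section GelfandZeitlinFunctions
open scoped Matrix.Norms.Operator

theorem contDiff_gzFunction (t : Family) (n : ℕ) (p : Index t n) {k : WithTop ℕ∞} :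
    ContDiff ℂ k (gzFunction t n p) :=
  (contDiff_invariant t p.1.1 p.2).comp
    (LinearMap.toContinuousLinearMap (cutoffLinear p.le)).contDiff

theorem differentiable_gzFunction (t : Family) (n : ℕ) (p : Index t n) :
    Differentiable ℂ (gzFunction t n p) :=
  (contDiff_gzFunction t n p (k := 1)).differentiable one_ne_zero

theorem fderiv_gzFunction (t : Family) (n : ℕ) (p : Index t n) (y v : Mat n) :
    fderiv ℂ (gzFunction t n p) y v
      = fderiv ℂ (invariant t p.1.1 p.2) (cutoff p.le y) (cutoff p.le v) := by
  have h1 : HasFDerivAt (invariant t p.1.1 p.2)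
      (fderiv ℂ (invariant t p.1.1 p.2) (cutoff p.le y)) (cutoff p.le y) :=
    ((contDiff_invariant t p.1.1 p.2 (k := 1)).differentiable one_ne_zero _).hasFDerivAt
  have h2 : HasFDerivAt (fun z : Mat n => cutoff p.le z)
      (LinearMap.toContinuousLinearMap (cutoffLinear p.le)) y :=
    (LinearMap.toContinuousLinearMap (cutoffLinear p.le)).hasFDerivAt
  have h3 : HasFDerivAt (gzFunction t n p) _ y := h1.comp y h2
  rw [h3.fderiv]
  rfl

/-- A choice of gradients of the Gelfand-Zeitlin functions at `y`. -/
theorem exists_gzFunction_gradient {t : Family} {n : ℕ} {y : Mat n} (hy : y ∈ lieAlg t n) :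
    ∃ A : (p : Index t n) → Mat p.1.1, ∀ p, A p ∈ lieAlg t p.1.1 ∧
      (∀ v ∈ lieAlg t n, fderiv ℂ (gzFunction t n p) y v = (resize n (A p) * v).trace) ∧
      Commute (A p) (cutoff p.le y) ∧
      ∃ κ : ℂ, gradientFactor t (cutoff p.le y) * A p
          = κ • cutoff p.le y ^ gradientExponent t p.1.1 p.2 ∧
        ((t = .so → Even p.1.1 → IsUnit (cutoff p.le y)) → κ ≠ 0) := by
  choose A hA using fun p : Index t n =>
    exists_gradient t p.2 (cutoff_mem_lieAlg t p.le hy)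
  refine ⟨A, fun p => ⟨(hA p).1, fun v hv => ?_, (hA p).2.2⟩⟩
  rw [fderiv_gzFunction, (hA p).2.1 _ (cutoff_mem_lieAlg t p.le hv), trace_resize_mul p.le]

theorem trace_mul_lie_gradient_eq_zero {t : Family} {n : ℕ} {y : Mat n}
    {A : (p : Index t n) → Mat p.1.1} (hA : ∀ p, Commute (A p) (cutoff p.le y)) (p q : Index t n) :
    (y * ⁅resize n (A p), resize n (A q)⁆).trace = 0 := by
  rcases le_total p.1.1 q.1.1 with h | h
  · exact trace_mul_lie_resize_eq_zero h q.le y (A p) (hA q)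
  · rw [← lie_skew, mul_neg, Matrix.trace_neg,
      trace_mul_lie_resize_eq_zero h p.le y (A q) (hA p), neg_zero]

theorem sum_index {t : Family} {n : ℕ} {E : Type*} [AddCommMonoid E] (f : Index t n → E)
    (g : ℕ → E) (h : ∀ (i : ℕ) (hi : i ∈ Finset.Icc 1 (n - 1)), ∑ j, f ⟨⟨i, hi⟩, j⟩ = g i) :
    ∑ p, f p = ∑ i ∈ Finset.Icc 1 (n - 1), g i := by
  rw [Fintype.sum_sigma, ← Finset.sum_coe_sort (Finset.Icc 1 (n - 1)) g]
  exact Finset.sum_congr rfl fun i _ => h i.1 i.2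

/-- Only the trivial combination of the gradients at a point of `(𝔤ₙ)_Ω` centralizes it. -/
theorem eq_zero_of_commute_gradient {t : Family} {n : ℕ} {x : Mat n} (hx : x ∈ omegaSet t n)
    {A : (p : Index t n) → Mat p.1.1} (hA : ∀ p, Commute (A p) (cutoff p.le x))
    (hli : ∀ i : Finset.Icc 1 (n - 1), LinearIndependent ℂ (M := Mat i.1) fun j : Fin (rank t i.1) => A ⟨i, j⟩)
    (c : Index t n → ℂ) (hc : Commute (∑ p, c p • resize n (A p)) x) : c = 0 := by
  set H := ∑ p, c p • resize n (A p) with hH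
  -- Level `i < n` carries its part of the combination and level `n` carries `-H`, so that the
  -- extensions sum to zero. The value at `i = 0` is irrelevant, as `Mat 0` is trivial.
  let Z : (i : ℕ) → Mat i := fun i =>
    if h : i ∈ Finset.Icc 1 (n - 1) then ∑ j, c ⟨⟨i, h⟩, j⟩ • A ⟨⟨i, h⟩, j⟩ else -resize i H
  have hZ1 : ∀ i (h : i ∈ Finset.Icc 1 (n - 1)),
      Z i = ∑ j, c ⟨⟨i, h⟩, j⟩ • A ⟨⟨i, h⟩, j⟩ := fun i h => dif_pos h
  have hZ : ∀ i ∈ Finset.Icc 1 n, Z i = 0 := by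
    rcases Nat.eq_zero_or_pos n with rfl | hn
    · simp
    have hZn : Z n = -H := by
      have h : n ∉ Finset.Icc 1 (n - 1) := by rw [Finset.mem_Icc]; omega
      have e : resize n H = H := by
        ext a b
        exact resize_apply H a b ⟨a.2, b.2⟩
      exact (dif_neg h).trans (congrArg _ e)
    refine eq_zero_of_sum_resize (fun i h2 hi => (hx.2 i h2 hi).2) Z n le_rfl (fun i hi => ?_) ?_
    · by_cases h : i ∈ Finset.Icc 1 (n - 1)
      · rw [hZ1 i h]
        exact Commute.sum_left _ _ _ fun j _ => (hA ⟨⟨i, h⟩, j⟩).smul_left _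
      · rw [Finset.mem_Icc] at h
        have h' : i = 0 ∨ i = n := by omega
        rcases h' with rfl | rfl
        · exact Subsingleton.elim _ _
        · rw [hZn]
          exact hc.neg_left
    · have e1 : Finset.Icc 1 n = insert n (Finset.Icc 1 (n - 1)) := by
        ext i; rw [Finset.mem_insert, Finset.mem_Icc, Finset.mem_Icc]; omega
      rw [e1, Finset.sum_insert (by rw [Finset.mem_Icc]; omega), hZn]
      have e2 : H = ∑ i ∈ Finset.Icc 1 (n - 1), resize n (Z i) := by
        refine sum_index _ _ fun i hi => ?_
        rw [hZ1 i hi]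
        change _ = resizeLinear i n _
        rw [map_sum]
        exact Finset.sum_congr rfl fun j _ => ((resizeLinear i n).map_smul _ _).symm
      have e3 : resize n (-H) = -H := by
        ext a b
        exact resize_apply (-H) a b ⟨a.2, b.2⟩
      rw [e3, ← e2, neg_add_cancel]
  funext ⟨⟨i, hi⟩, j⟩
  have h1 := hZ i (by rw [Finset.mem_Icc] at hi ⊢; omega)
  rw [hZ1 i hi] at h1
  exact Fintype.linearIndependent_iff.mp (hli ⟨i, hi⟩) _ h1 j

/-- By invariance of the trace form, a combination of differentials kills every `[a, x]` only if the
same combination of gradients commutes with `x`. -/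
theorem linearIndependent_gradient {t : Family} {n : ℕ} {x : Mat n} (hx : x ∈ omegaSet t n) :
    LinearIndependent ℂ fun (p : Index t n) (a : (lieAlg t n).toSubmodule) =>
      fderiv ℂ (gzFunction t n p) x ⁅(a : Mat n), x⁆ := by
  obtain ⟨A, hA⟩ := exists_gzFunction_gradient hx.1
  rw [Fintype.linearIndependent_iff]
  intro c hc
  refine congrFun (eq_zero_of_commute_gradient hx (fun p => (hA p).2.2.1) (fun i => ?_) c ?_)
  · have hi : i.1 ≤ n := (Finset.mem_Icc.mp i.2).2.trans (Nat.sub_le n 1)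
    have hreg := isStronglyRegularCutoff_of_omega hx hi
    choose κ hκ using fun p => (hA p).2.2.2
    exact linearIndependent_of_mul_eq_pow
      (B := gradientFactor t (cutoff hi x)) (κ := fun j => κ ⟨i, j⟩)
      (e := gradientExponent t i.1) hreg.linearIndependent_pow (gradientExponent_lt t i.1)
      (gradientExponent_injective t i.1) (fun j => (hκ ⟨i, j⟩).2 hreg.isUnit)
      (fun j => (hκ ⟨i, j⟩).1)
  · have hmem : ∑ p, c p • resize n (A p) ∈ lieAlg t n :=
      (lieAlg t n).toSubmodule.sum_mem fun p _ =>
        (lieAlg t n).toSubmodule.smul_mem _ (resize_mem_lieAlg t (hA p).1)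
    have h0 : ⁅x, ∑ p, c p • resize n (A p)⁆ = 0 := by
      refine eq_zero_of_trace_mul t (lie_mem_lieAlg hx.1 hmem) fun a ha => ?_
      rw [← trace_mul_lie', Finset.sum_mul, Matrix.trace_sum]
      have h1 := congrFun hc ⟨a, ha⟩
      rw [Finset.sum_apply] at h1
      refine Eq.trans (Finset.sum_congr rfl fun p _ => ?_) h1
      rw [Pi.smul_apply, (hA p).2.1 _ (lie_mem_lieAlg ha hx.1), smul_mul_assoc, Matrix.trace_smul]
    exact (sub_eq_zero.mp h0).symm

theorem exists_dual_directions {ι K V : Type*} [Fintype ι] [DecidableEq ι] [Field K]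
    [AddCommGroup V] [Module K V] (ψ : ι → V →ₗ[K] K)
    (h : LinearIndependent K fun k (a : V) => ψ k a) :
    ∃ a : ι → V, ∀ k l, ψ k (a l) = (1 : Matrix ι ι K) k l := by
  have h1 := span_flip_eq_top_iff_linearIndependent.mpr h
  have h2 : LinearMap.range (LinearMap.pi ψ) = ⊤ := by
    rw [eq_top_iff, ← h1, Submodule.span_le]
    rintro _ ⟨a, rfl⟩
    exact ⟨a, rfl⟩
  choose a ha using fun l => LinearMap.range_eq_top.mp h2 fun k => (1 : Matrix ι ι K) k l
  exact ⟨a, fun k l => congrFun (ha l) k⟩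

end GelfandZeitlinFunctions

/-! ### From independence at `x` to an open dense subset -/

section Density
open scoped Matrix.Norms.Operator

/-- The group is generated by exponentials: `exp z` lies on `s ↦ exp(s z)`, and pointwise products
and inverses of such curves stay in the group. Differentiability of the inverse is carried along for
the induction. -/
theorem exists_curve {t : Family} {n : ℕ} {g : (Mat n)ˣ} (hg : g ∈ group t n) :
    ∃ γ : ℂ → (Mat n)ˣ, γ 0 = 1 ∧ γ 1 = g ∧ (∀ s, γ s ∈ group t n) ∧
      Differentiable ℂ (fun s => (γ s : Mat n)) ∧
      Differentiable ℂ (fun s => (((γ s)⁻¹ : (Mat n)ˣ) : Mat n)) := by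
  induction hg using Subgroup.closure_induction with
  | mem g hg =>
    obtain ⟨z, hz, h⟩ := hg
    refine ⟨fun s => expUnit (s • z), Units.ext ?_, Units.ext ?_,
      fun s => expUnit_mem ((lieAlg t n).toSubmodule.smul_mem s hz), differentiable_exp_smul z, ?_⟩
    · change NormedSpace.exp ((0 : ℂ) • z) = 1
      rw [zero_smul, NormedSpace.exp_zero]
    · change NormedSpace.exp ((1 : ℂ) • z) = g
      rw [one_smul, h]
    · have h := differentiable_exp_smul (-z)
      simp only [smul_neg] at h
      exact h
  | one => exact ⟨fun _ => 1, rfl, rfl, fun _ => one_mem _, differentiable_const _,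
      differentiable_const _⟩
  | mul g h _ _ hg hh =>
    obtain ⟨γ, h0, h1, hm, hd, hd'⟩ := hg
    obtain ⟨δ, k0, k1, km, kd, kd'⟩ := hh
    refine ⟨fun s => γ s * δ s, by simp [h0, k0], by simp [h1, k1],
      fun s => mul_mem (hm s) (km s), hd.mul kd, ?_⟩
    have := kd'.mul hd'
    simp only [mul_inv_rev, Units.val_mul]
    exact this
  | inv g _ hg =>
    obtain ⟨γ, h0, h1, hm, hd, hd'⟩ := hg
    refine ⟨fun s => (γ s)⁻¹, by simp [h0], by simp [h1], fun s => inv_mem (hm s), hd', ?_⟩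
    simp only [inv_inv]
    exact hd

/-- A holomorphic function which is nonzero at `x` is nonzero on a dense subset of the orbit. -/
theorem subset_closure_ne_zero {t : Family} {n : ℕ} {x : Mat n} {Δ : Mat n → ℂ}
    (hΔ : Differentiable ℂ Δ) (hx : Δ x ≠ 0) :
    adjointOrbit t n x ⊆ closure (adjointOrbit t n x ∩ {y | Δ y ≠ 0}) := by
  rintro _ ⟨g, hg, rfl⟩
  obtain ⟨γ, h0, h1, hm, hd, hd'⟩ := exists_curve hg
  let δ : ℂ → Mat n := fun s => (γ s : Mat n) * x * (((γ s)⁻¹ : (Mat n)ˣ) : Mat n)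
  have hδ : Differentiable ℂ δ := (hd.mul_const x).mul hd'
  have hδ1 : δ 1 = (g : Mat n) * x * ((g⁻¹ : (Mat n)ˣ) : Mat n) := by simp only [δ, h1]
  have hδ0 : δ 0 = x := by simp [δ, h0]
  rw [← hδ1]
  by_contra hcl
  have hev : ∀ᶠ s in 𝓝 (1 : ℂ), δ s ∈ (closure (adjointOrbit t n x ∩ {y | Δ y ≠ 0}))ᶜ :=
    hδ.continuous.continuousAt.eventually_mem (isClosed_closure.isOpen_compl.mem_nhds hcl)
  -- If `δ 1` were outside the closure, `Δ ∘ δ` would vanish near `1`, hence on all of `ℂ`,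
  -- contradicting `Δ x ≠ 0` at `s = 0`.
  have hzero : (fun s => Δ (δ s)) =ᶠ[𝓝 1] 0 := by
    filter_upwards [hev] with s hs
    by_contra hne
    exact hs (subset_closure ⟨⟨γ s, hm s, rfl⟩, hne⟩)
  have hanal : AnalyticOnNhd ℂ (fun s => Δ (δ s)) Set.univ := fun s _ =>
    (hΔ.comp hδ).analyticAt s
  have := hanal.eqOn_zero_of_preconnected_of_eventuallyEq_zero isPreconnected_univ
    (Set.mem_univ 1) hzero (Set.mem_univ 0)
  simp only [hδ0] at this
  exact hx this

theorem differentiable_det {ι E : Type*} [Fintype ι] [DecidableEq ι] [NormedAddCommGroup E]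
    [NormedSpace ℂ E] {F : ι → ι → E → ℂ} (hF : ∀ k l, Differentiable ℂ (F k l)) :
    Differentiable ℂ fun y => (Matrix.of fun k l => F k l y).det := by
  simp only [Matrix.det_apply', Matrix.of_apply]
  refine Differentiable.fun_sum fun σ _ => Differentiable.const_mul ?_ _
  exact fun y => (HasFDerivAt.finsetProd fun i _ => (hF (σ i) i y).hasFDerivAt).differentiableAt

theorem differentiable_fderiv_lie {n : ℕ} {f : Mat n → ℂ} (hf : ContDiff ℂ 2 f) (a : Mat n) :
    Differentiable ℂ fun y => fderiv ℂ f y ⁅a, y⁆ := by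
  have h1 : Differentiable ℂ (fderiv ℂ f) :=
    (hf.fderiv_right (m := 1) (by norm_num)).differentiable one_ne_zero
  have h2 : Differentiable ℂ fun y : Mat n => ⁅a, y⁆ :=
    (LinearMap.toContinuousLinearMap (LieAlgebra.ad ℂ (Mat n) a : Mat n →ₗ[ℂ] Mat n)).differentiable
  exact h1.clm_apply h2

theorem exists_independent_dense {t : Family} {n : ℕ} {x : Mat n} (hx : x ∈ omegaSet t n) :
    ∃ U : Set (Mat n), IsOpen U ∧ adjointOrbit t n x ⊆ closure (adjointOrbit t n x ∩ U) ∧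
      ∀ y ∈ adjointOrbit t n x ∩ U,
        LinearIndependent ℂ fun k => differential (adjointOrbit t n x) (gzFunction t n k) y := by
  classical
  let ψ : Index t n → (lieAlg t n).toSubmodule →ₗ[ℂ] ℂ := fun p =>
    (fderiv ℂ (gzFunction t n p) x).toLinearMap.comp
      ((-(LieAlgebra.ad ℂ (Mat n) x : Mat n →ₗ[ℂ] Mat n)).comp (lieAlg t n).toSubmodule.subtype)
  have hψ : ∀ p (a : (lieAlg t n).toSubmodule),
      ψ p a = fderiv ℂ (gzFunction t n p) x ⁅(a : Mat n), x⁆ := by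
    intro p a
    rw [← lie_skew]
    rfl
  obtain ⟨a, ha⟩ := exists_dual_directions ψ (by simpa only [hψ] using linearIndependent_gradient hx)
  -- The directions `a l` are dual to the differentials at `x`, so this determinant is `1` there;
  -- wherever it is nonzero the vectors `[a l, y]` detect independence.
  let Δ : Mat n → ℂ := fun y =>
    (Matrix.of fun k l => fderiv ℂ (gzFunction t n k) y ⁅((a l : Mat n)), y⁆).det
  have hΔ : Differentiable ℂ Δ := differentiable_det fun k l =>
    differentiable_fderiv_lie (contDiff_gzFunction t n k) _
  have hΔx : Δ x ≠ 0 := by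
    have : (Matrix.of fun k l => fderiv ℂ (gzFunction t n k) x ⁅((a l : Mat n)), x⁆) = 1 := by
      ext k l
      rw [Matrix.of_apply, ← hψ, ha]
    simp only [Δ, this, Matrix.det_one]
    exact one_ne_zero
  refine ⟨{y | Δ y ≠ 0}, isOpen_ne_fun hΔ.continuous continuous_const,
    subset_closure_ne_zero hΔ hΔx, ?_⟩
  rintro y ⟨hy, hΔy⟩
  rw [Fintype.linearIndependent_iff]
  intro c hc
  refine congrFun (Matrix.eq_zero_of_vecMul_eq_zero hΔy (funext fun l => ?_))
  have h1 := congrFun hc ⟨⁅(a l : Mat n), y⁆, lie_mem_tangentSpace hy (a l).2⟩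
  rw [Finset.sum_apply] at h1
  refine Eq.trans (Finset.sum_congr rfl fun k _ => ?_) h1
  rw [Pi.smul_apply, differential_apply _ (differentiable_gzFunction t n k)]
  rfl

end Density

/-! ### Complete integrability -/

section Integrable
open scoped Matrix.Norms.Operator

theorem isCompletelyIntegrableSystem_gzFunction {t : Family} {n : ℕ} {x : Mat n}
    (hx : x ∈ omegaSet t n) :
    IsCompletelyIntegrableSystem (adjointOrbit t n x) (kks t n) (gzFunction t n) where
  dim_eq y hy := finrank_tangentSpace hx hy
  hamiltonian y hy k := by
    obtain ⟨A, hA⟩ := exists_gzFunction_gradient (adjointOrbit_subset hx.1 y hy)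
    have h := isHamiltonianVector_iff hx hy (differentiable_gzFunction t n k)
      (resize_mem_lieAlg t (hA k).1) (hA k).2.1
    exact ⟨_, (h _).mpr rfl, fun ξ hξ => (h ξ).mp hξ⟩
  poisson_commute y hy k l ξ η hξ hη := by
    obtain ⟨A, hA⟩ := exists_gzFunction_gradient (adjointOrbit_subset hx.1 y hy)
    have h := fun p => isHamiltonianVector_iff hx hy (differentiable_gzFunction t n p)
      (resize_mem_lieAlg t (hA p).1) (hA p).2.1
    rw [(h k ξ).mp hξ, (h l η).mp hη, ← lie_skew, ← lie_skew y, ← neg_lie, ← neg_lie,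
      kks_apply t n y _ _ (neg_mem (resize_mem_lieAlg t (hA k).1))
        (neg_mem (resize_mem_lieAlg t (hA l).1)), neg_lie, lie_neg, neg_neg]
    exact trace_mul_lie_gradient_eq_zero (fun p => (hA p).2.2.1) k l
  independent := exists_independent_dense hx

end Integrable

end GelfandZeitlin

theorem corollary3p5 (t : GelfandZeitlin.Family) (n : ℕ) (x : GelfandZeitlin.Mat n)
    (hx : x ∈ GelfandZeitlin.omegaSet t n) :
    GelfandZeitlin.IsCompletelyIntegrableSystem (GelfandZeitlin.adjointOrbit t n x)
      (GelfandZeitlin.kks t n) (GelfandZeitlin.gzFunction t n) := by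
  exact GelfandZeitlin.isCompletelyIntegrableSystem_gzFunction hx
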